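/- **Setting.** The metatheory is classical set theory with the axiom of choice. Let $\mathfrak{F}\mathbf{Set}$ be the category whose objects are pairs $\mathcal F=(C,\mathcal F)$ of a set $C$ and a (possibly improper) filter $\mathcal F$ on $C$, and whose morphisms $\mathcal F\to\mathcal G=(D,\mathcal G)$ are germs of continuous partial maps: partial functions $C\rightharpoonup D$ for which the inverse image of every member of $\mathcal G$ belongs to $\mathcal F$ (in particular, the domain does), two of them being identified if they are defined and equal on some member of $\mathcal F$. A set $S$ is identified with the filter $(S,\{S\})$. Let $K$ be the Grothendieck topology whose covering sieves are those that contain a finite family $\{\beta_k:\mathcal G_k\to\mathcal F\}_{k=1}^n$ such that $\beta_1V_1\cup\dots\cup\beta_nV_n\in\mathcal F$ for all $V_1\in\mathcal G_1,\dots,V_n\in\mathcal G_n$. Let $\mathcal N=\mathrm{Sh}(\mathfrak{F}\mathbf{Set},K)$. The topology $K$ is subcanonical; $\mathbf yS=\mathrm{Hom}(-,S)$ is the sheaf represented by $S$, and $\Delta S\subseteq\mathbf yS$ is the subsheaf of those $\alpha:\mathcal F\to S$ that take a finite number of values, i.e. for which $\alpha^{-1}A\in\mathcal F$ for some finite $A\subseteq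 S$. Let $\mathcal L$ be a many-sorted first-order language with a fixed interpretation in $\mathbf{Set}$, whose types are generated from base types by $S\mapsto S^*$ (finite sequences) and $(S,T)\mapsto (S\to T)$ (functions), with equality, function application, membership $y\in s$ in a finite sequence, and finite sequence application $s[x]:=s_0(x)\cdot\ldots\cdot s_{|s|-1}(x)$ (concatenation) for $s:(S\to T^*)^*$. Types are identified with the sets that they denote, which may be empty. Let $\mathcal L_{\mathrm{st}}$ be $\mathcal L$ with an additional unary predicate $\mathrm{st}_S$ for every type $S$; formulas without $\mathrm{st}$ are called internal. Write $\forall^{\mathrm{st}}x:S\,\Phi$ for $\forall x:S\,(\mathrm{st}(x)\to\Phi)$, $\exists^{\mathrm{st}}x:S\,\Phi$ for $\exists x:S\,(\mathrm{st}(x)\wedge\Phi)$, and $\exists y\in s\,\Phi$ for $\exists y\,(y\in s\wedge\Phi)$. Interpret $\mathcal L_{\mathrm{st}}$ in $\mathcal N$ by the forcing semantics of the topos, with $\llbracket S\rrbracket=\mathbf yS$, with $\mathbf yf$ for a function symbol $f$, $\mathbf yR$ for a relation symbol $R$, and $\llbracket\mathrm{st}_S\rrbracket=\Delta S$. A formula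 holds in $\mathcal N$, written $\Vdash\Phi$, if $\mathcal F\Vdash\Phi(\alpha)$ for every filter $\mathcal F$ and all values $\alpha$ at $\mathcal F$ of its free variables. **Proposition.** 1. The principle $\mathsf{HAC}^{\mathrm{st}}$ holds in $\mathcal N$: for all types $S,T$ and every formula $\Phi(z,x,y)$ of $\mathcal L_{\mathrm{st}}$ with $x:S$, $y:T$ and arbitrary further parameters $z$, $$\Vdash\ \forall^{\mathrm{st}}x:S\,\exists^{\mathrm{st}}y:T\,\Phi(z,x,y)\ \to\ \exists^{\mathrm{st}}f:S\to T^*\,\forall^{\mathrm{st}}x:S\,\exists y\in f(x)\,\Phi(z,x,y),$$ and also, in the version with finite sequence application, $$\Vdash\ \forall^{\mathrm{st}}x:S\,\exists^{\mathrm{st}}y:T\,\Phi(z,x,y)\ \to\ \exists^{\mathrm{st}}f:(S\to T^*)^*\,\forall^{\mathrm{st}}x:S\,\exists y\in f[x]\,\Phi(z,x,y).$$ 2. Conversely, let $\varphi(x,y)$ be an internal formula with no free variables other than $x:S$ and $y:T$. Then $\Vdash\forall^{\mathrm{st}}x:S\,\exists^{\mathrm{st}}y:T\,\varphi(x,y)$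 if and only if $\forall x\in S\,\exists y\in T\,\varphi(x,y)$ is true in $\mathbf{Set}$; and $\Vdash\exists^{\mathrm{st}}f:S\to T^*\,\forall^{\mathrm{st}}x:S\,\exists y\in f(x)\,\varphi(x,y)$ if and only if it is true in $\mathbf{Set}$ that there is a function $f:S\to T^*$ with $\forall x\in S\,\exists y\in f(x)\,\varphi(x,y)$; the latter equivalence also holds for $\exists^{\mathrm{st}}f:(S\to T^*)^*\,\forall^{\mathrm{st}}x:S\,\exists y\in f[x]\,\varphi(x,y)$ in place of $\exists^{\mathrm{st}}f:S\to T^*\,\forall^{\mathrm{st}}x:S\,\exists y\in f(x)\,\varphi(x,y)$. Consequently, if (either version of) the instance of $\mathsf{HAC}^{\mathrm{st}}$ for $\varphi$ holds in $\mathcal N$, then the herbrandised axiom of choice for $\varphi$ holds in $\mathbf{Set}$: $$\forall x\in S\,\exists y\in T\,\varphi(x,y)\ \to\ \exists f\in S\to T^*\ \forall x\in S\,\exists y\in f(x)\,\varphi(x,y).$$ -/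

import Mathlib

universe u v

open CategoryTheory Opposite

/-! ## The category of filters of sets -/

/-- An object `(C, 𝓕)` of the filter category over `Set`: a set with a filter of subsets. The
improper filter `⊥` is allowed. -/
structure FSet : Type (u + 1) where
  carrier : Type u
  filter : Filter carrier

namespace FSet

/-- A continuous partial map: the inverse image of every set of the target filter (in particular
its domain, the inverse image of the whole set) belongs to the source filter. -/
structure ContMap (X Y : FSet.{u}) where
  toPFun : X.carrier →. Y.carrier
  preimage_mem : ∀ V ∈ Y.filter, toPFun.preimage V ∈ X.filter

/-- Two continuous partial maps are equivalent when they are defined and equal on a common set of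
the source filter. -/
def germSetoid (X Y : FSet.{u}) : Setoid (ContMap X Y) where
  r f g := {u | ∃ y, y ∈ f.toPFun u ∧ y ∈ g.toPFun u} ∈ X.filter
  iseqv := by
    refine ⟨fun f => ?_, fun {f g} h => ?_, fun {f g k} h₁ h₂ => ?_⟩
    · filter_upwards [f.preimage_mem _ Filter.univ_mem]
      rintro u ⟨y, -, hy⟩
      exact ⟨y, hy, hy⟩
    · filter_upwards [h]
      rintro u ⟨y, h1, h2⟩
      exact ⟨y, h2, h1⟩
    · filter_upwards [h₁, h₂]
      rintro u ⟨y, h1, h2⟩ ⟨z, h3, h4⟩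
      exact ⟨y, h1, Part.mem_unique h3 h2 ▸ h4⟩

/-- Morphisms of filters: germs of continuous partial maps. -/
def Germ (X Y : FSet.{u}) : Type u := Quotient (germSetoid X Y)

/-- The germ of a continuous partial map. -/
def ContMap.germ {X Y : FSet.{u}} (f : ContMap X Y) : Germ X Y := Quotient.mk (germSetoid X Y) f

theorem ContMap.germ_eq_iff {X Y : FSet.{u}} (f g : ContMap X Y) :
    f.germ = g.germ ↔ {u | ∃ y, y ∈ f.toPFun u ∧ y ∈ g.toPFun u} ∈ X.filter :=
  Quotient.eq (r := germSetoid X Y)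

theorem Germ.exists_rep {X Y : FSet.{u}} (α : Germ X Y) : ∃ f : ContMap X Y, f.germ = α :=
  Quotient.exists_rep α

/-- The identity map. -/
def ContMap.id (X : FSet.{u}) : ContMap X X where
  toPFun := PFun.id X.carrier
  preimage_mem V hV := by
    filter_upwards [hV] with u hu
    exact ⟨u, hu, Part.mem_some u⟩

/-- Composition of continuous partial maps. -/
def ContMap.comp {X Y Z : FSet.{u}} (g : ContMap Y Z) (f : ContMap X Y) : ContMap X Z where
  toPFun := g.toPFun.comp f.toPFun
  preimage_mem V hV := by
    filter_upwards [f.preimage_mem _ (g.preimage_mem V hV)]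
    rintro u ⟨y, ⟨z, hz, hyz⟩, hy⟩
    exact ⟨z, hz, Part.mem_bind hy hyz⟩

/-- Composition of germs. -/
def Germ.comp {X Y Z : FSet.{u}} (α : Germ X Y) (β : Germ Y Z) : Germ X Z :=
  Quotient.map₂ (fun f g => ContMap.comp g f) (by
    intro f f' hf g g' hg
    change _ ∈ X.filter
    filter_upwards [hf, f.preimage_mem _ hg]
    rintro u ⟨y, h1, h2⟩ ⟨y', ⟨z, h3, h4⟩, h5⟩
    obtain rfl := Part.mem_unique h1 h5
    exact ⟨z, Part.mem_bind h1 h3, Part.mem_bind h2 h4⟩) α β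

instance : Category FSet.{u} where
  Hom := Germ
  id X := (ContMap.id X).germ
  comp := Germ.comp
  id_comp := by
    rintro X Y ⟨f⟩
    refine (ContMap.germ_eq_iff _ _).2 ?_
    filter_upwards [f.preimage_mem _ Filter.univ_mem]
    rintro u ⟨y, -, hy⟩
    exact ⟨y, Part.mem_bind (Part.mem_some u) hy, hy⟩
  comp_id := by
    rintro X Y ⟨f⟩
    refine (ContMap.germ_eq_iff _ _).2 ?_
    filter_upwards [f.preimage_mem _ Filter.univ_mem]
    rintro u ⟨y, -, hy⟩
    exact ⟨y, Part.mem_bind hy (Part.mem_some y), hy⟩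
  assoc := by
    rintro X Y Z W ⟨f⟩ ⟨g⟩ ⟨h⟩
    refine (ContMap.germ_eq_iff _ _).2 ?_
    filter_upwards [f.preimage_mem _ (g.preimage_mem _ (h.preimage_mem _ Filter.univ_mem))]
    rintro u ⟨y, ⟨z, ⟨w, -, hw⟩, hz⟩, hy⟩
    exact ⟨w, Part.mem_bind (Part.mem_bind hy hz) hw, Part.mem_bind hy (Part.mem_bind hz hw)⟩

/-- A continuous partial map as a morphism. -/
def ContMap.hom {X Y : FSet.{u}} (f : ContMap X Y) : X ⟶ Y := f.germ

theorem ContMap.hom_eq_iff {X Y : FSet.{u}} (f g : ContMap X Y) :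
    f.hom = g.hom ↔ {u | ∃ y, y ∈ f.toPFun u ∧ y ∈ g.toPFun u} ∈ X.filter :=
  ContMap.germ_eq_iff f g

theorem exists_rep {X Y : FSet.{u}} (α : X ⟶ Y) : ∃ f : ContMap X Y, f.hom = α :=
  Germ.exists_rep α

theorem ContMap.hom_comp {X Y Z : FSet.{u}} (f : ContMap X Y) (g : ContMap Y Z) :
    f.hom ≫ g.hom = (g.comp f).hom := rfl

/-- The embedding of `Set` into the category of filters: `S` becomes the simple filter
`(S, {S})`. -/
abbrev simple (S : Type u) : FSet.{u} := ⟨S, ⊤⟩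

/-- A function as a morphism between simple filters. -/
def simpleMap {S T : Type u} (f : S → T) : simple S ⟶ simple T :=
  ContMap.hom
    { toPFun := PFun.lift f
      preimage_mem := fun V hV => by
        obtain rfl := Filter.mem_top.1 hV
        refine Filter.mem_top.2 (Set.eq_univ_of_forall fun u => ?_)
        exact ⟨f u, trivial, Part.mem_some _⟩ }

/-- The morphism `⟨α, β⟩` into the simple filter on `S × T`, which is the product of the simple
filters on `S` and `T`. -/
def pair {X : FSet.{u}} {S T : Type u} (α : X ⟶ simple S) (β : X ⟶ simple T) :
    X ⟶ simple (S × T) :=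
  Quotient.map₂ (sa := germSetoid X (simple S)) (sb := germSetoid X (simple T))
    (sc := germSetoid X (simple (S × T)))
    (fun f g =>
      { toPFun := fun u => (f.toPFun u).bind fun s => (g.toPFun u).map fun t => (s, t)
        preimage_mem := fun V hV => by
          obtain rfl := Filter.mem_top.1 hV
          filter_upwards [f.preimage_mem _ Filter.univ_mem, g.preimage_mem _ Filter.univ_mem]
          rintro u ⟨s, -, hs⟩ ⟨t, -, ht⟩
          exact ⟨(s, t), trivial, Part.mem_bind hs (Part.mem_map _ ht)⟩ })
    (by
      intro f f' hf g g' hg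
      change _ ∈ X.filter
      filter_upwards [hf, hg]
      rintro u ⟨s, h1, h2⟩ ⟨t, h3, h4⟩
      exact ⟨(s, t), Part.mem_bind h1 (Part.mem_map _ h3), Part.mem_bind h2 (Part.mem_map _ h4)⟩)
    α β

/-! ## The precanonical topology and the topos of sheaves -/

/-- The image filter of a morphism: `A` belongs to it when the inverse image of `A` belongs to the
source filter. -/
def pushforward {X Y : FSet.{u}} (α : X ⟶ Y) : Filter Y.carrier where
  sets := {A | ∃ f : ContMap X Y, f.hom = α ∧ f.toPFun.preimage A ∈ X.filter}
  univ_sets := by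
    obtain ⟨f, hf⟩ := exists_rep α
    exact ⟨f, hf, f.preimage_mem _ Filter.univ_mem⟩
  sets_of_superset := by
    rintro A B ⟨f, hf, hA⟩ hAB
    exact ⟨f, hf, Filter.mem_of_superset hA (PFun.preimage_mono _ hAB)⟩
  inter_sets := by
    rintro A B ⟨f, hf, hA⟩ ⟨g, hg, hB⟩
    refine ⟨f, hf, ?_⟩
    filter_upwards [hA, hB, (ContMap.hom_eq_iff f g).1 (hf.trans hg.symm)]
    rintro u ⟨a, ha, ha'⟩ ⟨b, hb, hb'⟩ ⟨y, hy, hy'⟩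
    obtain rfl := Part.mem_unique ha' hy
    obtain rfl := Part.mem_unique hb' hy'
    exact ⟨_, ⟨ha, hb⟩, ha'⟩

theorem ContMap.mem_pushforward {X Y : FSet.{u}} (f : ContMap X Y) (A : Set Y.carrier) :
    A ∈ pushforward f.hom ↔ f.toPFun.preimage A ∈ X.filter := by
  refine ⟨?_, fun h => ⟨f, rfl, h⟩⟩
  rintro ⟨g, hg, hA⟩
  filter_upwards [hA, (ContMap.hom_eq_iff g f).1 hg]
  rintro u ⟨a, ha, ha'⟩ ⟨y, hy, hy'⟩
  obtain rfl := Part.mem_unique ha' hy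
  exact ⟨_, ha, hy'⟩

/-- A family `β k : G k ⟶ X` covers `X` when its images cover `X`: whenever the sets `V k` belong
to the filters `G k`, the union of their images under the `β k` belongs to the filter `X`. -/
def Covers {ι : Type} {X : FSet.{u}} {G : ι → FSet.{u}} (β : ∀ k, G k ⟶ X) : Prop :=
  ∀ f : ∀ k, ContMap (G k) X, (∀ k, (f k).hom = β k) →
    ∀ V : ∀ k, Set (G k).carrier, (∀ k, V k ∈ (G k).filter) →
      (⋃ k, (f k).toPFun.image (V k)) ∈ X.filter

theorem covers_iff {ι : Type} {X : FSet.{u}} {G : ι → FSet.{u}} (β : ∀ k, G k ⟶ X) :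
    Covers β ↔ ∀ A : Set X.carrier, (∀ k, A ∈ pushforward (β k)) → A ∈ X.filter := by
  constructor
  · intro h A hA
    choose f hf hA using hA
    refine Filter.mem_of_superset (h f hf _ hA) (Set.iUnion_subset fun k => ?_)
    rintro y ⟨v, ⟨a, ha, hva⟩, hy⟩
    exact Part.mem_unique hva hy ▸ ha
  · intro h f hf V hV
    refine h _ fun k => ⟨f k, hf k, ?_⟩
    filter_upwards [hV k, (f k).preimage_mem _ Filter.univ_mem]
    rintro v hv ⟨y, -, hy⟩
    exact ⟨y, Set.mem_iUnion.2 ⟨k, v, hv, hy⟩, hy⟩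

theorem mem_pushforward_comp {X Y Z : FSet.{u}} (α : X ⟶ Y) (β : Y ⟶ Z) (A : Set Z.carrier)
    {B : Set Y.carrier} (hB : B ∈ pushforward α) (b : ContMap Y Z) (hb : b.hom = β)
    (hBA : B ⊆ b.toPFun.preimage A) : A ∈ pushforward (α ≫ β) := by
  subst hb
  obtain ⟨f, rfl⟩ := exists_rep α
  rw [ContMap.mem_pushforward] at hB
  rw [ContMap.hom_comp, ContMap.mem_pushforward]
  filter_upwards [hB]
  rintro u ⟨y, hy, hy'⟩
  obtain ⟨z, hz, hz'⟩ := hBA hy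
  exact ⟨z, hz, Part.mem_bind hy' hz'⟩

theorem mem_pushforward_comp_iff {X Y Z : FSet.{u}} (α : X ⟶ Y) (b : ContMap Y Z)
    (A : Set Z.carrier) :
    A ∈ pushforward (α ≫ b.hom) ↔ b.toPFun.preimage A ∈ pushforward α := by
  refine ⟨fun h => ?_, fun h => mem_pushforward_comp α b.hom A h b rfl subset_rfl⟩
  obtain ⟨f, rfl⟩ := exists_rep α
  rw [ContMap.hom_comp, ContMap.mem_pushforward] at h
  rw [ContMap.mem_pushforward]
  filter_upwards [h]
  rintro u ⟨z, hz, hz'⟩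
  obtain ⟨y, hy, hyz⟩ := Part.mem_bind_iff.1 hz'
  exact ⟨y, ⟨z, hz, hyz⟩, hy⟩

/-- Pullback of two morphisms, on the product of the underlying sets. -/
theorem exists_pullback {X Y Z : FSet.{u}} (a : ContMap X Z) (b : ContMap Y Z) :
    ∃ (P : FSet.{u}) (p : P ⟶ X) (q : P ⟶ Y), p ≫ a.hom = q ≫ b.hom ∧
      ∀ A : Set X.carrier, A ∈ pushforward p → ∃ U ∈ X.filter, ∃ V ∈ Y.filter,
        ∀ u ∈ U, ∀ v ∈ V, ∀ z, z ∈ a.toPFun u → z ∈ b.toPFun v → u ∈ A := by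
  let E : Set (X.carrier × Y.carrier) := {w | ∃ z, z ∈ a.toPFun w.1 ∧ z ∈ b.toPFun w.2}
  let P : FSet.{u} := ⟨X.carrier × Y.carrier,
    (X.filter.comap Prod.fst ⊓ Y.filter.comap Prod.snd) ⊓ Filter.principal E⟩
  let p : ContMap P X :=
    { toPFun := PFun.lift Prod.fst
      preimage_mem := fun V hV => by
        rw [PFun.coe_preimage]
        exact Filter.mem_inf_of_left (Filter.mem_inf_of_left (Filter.preimage_mem_comap hV)) }
  let q : ContMap P Y :=
    { toPFun := PFun.lift Prod.snd
      preimage_mem := fun V hV => by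
        rw [PFun.coe_preimage]
        exact Filter.mem_inf_of_left (Filter.mem_inf_of_right (Filter.preimage_mem_comap hV)) }
  refine ⟨P, p.hom, q.hom, ?_, ?_⟩
  · rw [ContMap.hom_comp, ContMap.hom_comp, ContMap.hom_eq_iff]
    refine Filter.mem_inf_of_right ?_
    rintro w ⟨z, hz, hz'⟩
    exact ⟨z, Part.mem_bind (Part.mem_some _) hz, Part.mem_bind (Part.mem_some _) hz'⟩
  · intro A hA
    rw [ContMap.mem_pushforward] at hA
    change PFun.preimage (PFun.lift Prod.fst) A ∈ _ at hA
    rw [PFun.coe_preimage, Filter.mem_inf_principal, ← Filter.prod_eq_inf,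
      Filter.mem_prod_iff] at hA
    obtain ⟨U, hU, V, hV, hUV⟩ := hA
    exact ⟨U, hU, V, hV, fun u hu v hv z h1 h2 => hUV (Set.mk_mem_prod hu hv) ⟨z, h1, h2⟩⟩

/-- The pullback of a finite cover along any morphism is a cover. -/
theorem exists_pullback_cover {ι : Type} [Finite ι] {X Y : FSet.{u}} {G : ι → FSet.{u}}
    {β : ∀ k, G k ⟶ X} (hβ : Covers β) (α : Y ⟶ X) :
    ∃ (P : ι → FSet.{u}) (p : ∀ k, P k ⟶ Y) (q : ∀ k, P k ⟶ G k),
      (∀ k, p k ≫ α = q k ≫ β k) ∧ Covers p := by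
  obtain ⟨a, rfl⟩ := exists_rep α
  choose b hb using fun k => exists_rep (β k)
  choose P p q hpq hP using fun k => exists_pullback a (b k)
  refine ⟨P, p, q, fun k => by rw [hpq, hb], (covers_iff p).2 fun A hA => ?_⟩
  choose U hU V hV hUV using fun k => hP k A (hA k)
  have h1 := hβ b hb V hV
  filter_upwards [a.preimage_mem _ h1, Filter.iInter_mem.2 hU]
  rintro u ⟨z, hz, hz'⟩ hu
  obtain ⟨k, v, hv, hvz⟩ := Set.mem_iUnion.1 hz
  exact hUV k u (Set.mem_iInter.1 hu k) v hv z hz' hvz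

theorem Covers.hom_ext {ι : Type} {X Y : FSet.{u}} {G : ι → FSet.{u}} {β : ∀ k, G k ⟶ X}
    (hβ : Covers β) (γ δ : X ⟶ Y) (h : ∀ k, β k ≫ γ = β k ≫ δ) : γ = δ := by
  obtain ⟨c, rfl⟩ := exists_rep γ
  obtain ⟨d, rfl⟩ := exists_rep δ
  rw [ContMap.hom_eq_iff]
  refine (covers_iff β).1 hβ _ fun k => ?_
  obtain ⟨b, hb⟩ := exists_rep (β k)
  have := h k
  rw [← hb, ContMap.hom_comp, ContMap.hom_comp, ContMap.hom_eq_iff] at this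
  rw [← hb, ContMap.mem_pushforward]
  filter_upwards [this]
  rintro u ⟨y, hy, hy'⟩
  obtain ⟨x, hx, hxy⟩ := Part.mem_bind_iff.1 hy
  obtain ⟨x', hx', hxy'⟩ := Part.mem_bind_iff.1 hy'
  obtain rfl := Part.mem_unique hx hx'
  exact ⟨x, ⟨y, hxy, hxy'⟩, hx⟩

/-- The precanonical topology `K`: a sieve is covering when it contains a finite cover. -/
def K : GrothendieckTopology FSet.{u} where
  sieves X := {R | ∃ (ι : Type) (_ : Finite ι) (G : ι → FSet.{u}) (β : ∀ k, G k ⟶ X),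
    (∀ k, R (β k)) ∧ Covers β}
  top_mem' X := by
    refine ⟨Unit, inferInstance, fun _ => X, fun _ => 𝟙 X, fun _ => trivial,
      (covers_iff _).2 fun A hA => ?_⟩
    have h := ((ContMap.id X).mem_pushforward A).1 (hA ())
    filter_upwards [h]
    rintro u ⟨y, hy, hy'⟩
    exact Part.mem_some_iff.1 hy' ▸ hy
  pullback_stable' := by
    rintro X Y R α ⟨ι, _, G, β, hR, hβ⟩
    obtain ⟨P, p, q, hpq, hp⟩ := exists_pullback_cover hβ α
    refine ⟨ι, inferInstance, P, p, fun k => ?_, hp⟩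
    change R (p k ≫ α)
    rw [hpq]
    exact R.downward_closed (hR k) _
  transitive' := by
    rintro X S ⟨ι, _, G, β, hS, hβ⟩ R hR
    choose κ hκ H γ hRγ hγ using fun k => hR (hS k)
    refine ⟨Σ k, κ k, inferInstance, fun i => H i.1 i.2, fun i => γ i.1 i.2 ≫ β i.1,
      fun i => hRγ i.1 i.2, (covers_iff _).2 fun A hA => ?_⟩
    refine (covers_iff β).1 hβ A fun k => ?_
    obtain ⟨b, hb⟩ := exists_rep (β k)
    rw [← hb, ContMap.mem_pushforward]
    refine (covers_iff _).1 (hγ k) _ fun l => ?_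
    rw [← mem_pushforward_comp_iff, hb]
    exact hA ⟨k, l⟩

/-- Gluing along finite covers. -/
theorem Covers.exists_glue {ι : Type} [Finite ι] {X Y : FSet.{u}} {G : ι → FSet.{u}}
    {β : ∀ k, G k ⟶ X} (hβ : Covers β) (γ : ∀ k, G k ⟶ Y)
    (h : ∀ (k l : ι) (P : FSet.{u}) (p : P ⟶ G k) (q : P ⟶ G l),
      p ≫ β k = q ≫ β l → p ≫ γ k = q ≫ γ l) :
    ∃ δ : X ⟶ Y, ∀ k, β k ≫ δ = γ k := by
  classical
  choose b hb using fun k => exists_rep (β k)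
  choose c hc using fun k => exists_rep (γ k)
  have key : ∀ k l, ∃ U ∈ (G k).filter, ∃ V ∈ (G l).filter, ∀ u ∈ U, ∀ v ∈ V, ∀ z,
      z ∈ (b k).toPFun u → z ∈ (b l).toPFun v →
        ∃ y, y ∈ (c k).toPFun u ∧ y ∈ (c l).toPFun v := by
    intro k l
    let E : Set ((G k).carrier × (G l).carrier) :=
      {w | ∃ z, z ∈ (b k).toPFun w.1 ∧ z ∈ (b l).toPFun w.2}
    let P : FSet.{u} := ⟨(G k).carrier × (G l).carrier,
      ((G k).filter.comap Prod.fst ⊓ (G l).filter.comap Prod.snd) ⊓ Filter.principal E⟩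
    let p : ContMap P (G k) :=
      { toPFun := PFun.lift Prod.fst
        preimage_mem := fun V hV => by
          rw [PFun.coe_preimage]
          exact Filter.mem_inf_of_left (Filter.mem_inf_of_left (Filter.preimage_mem_comap hV)) }
    let q : ContMap P (G l) :=
      { toPFun := PFun.lift Prod.snd
        preimage_mem := fun V hV => by
          rw [PFun.coe_preimage]
          exact Filter.mem_inf_of_left (Filter.mem_inf_of_right (Filter.preimage_mem_comap hV)) }
    have hpq : p.hom ≫ β k = q.hom ≫ β l := by
      rw [← hb k, ← hb l, ContMap.hom_comp, ContMap.hom_comp, ContMap.hom_eq_iff]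
      refine Filter.mem_inf_of_right ?_
      rintro w ⟨z, hz, hz'⟩
      exact ⟨z, Part.mem_bind (Part.mem_some _) hz, Part.mem_bind (Part.mem_some _) hz'⟩
    have h2 := h k l P _ _ hpq
    rw [← hc k, ← hc l, ContMap.hom_comp, ContMap.hom_comp, ContMap.hom_eq_iff] at h2
    change _ ∈ (_ ⊓ Filter.principal E : Filter _) at h2
    rw [Filter.mem_inf_principal, ← Filter.prod_eq_inf, Filter.mem_prod_iff] at h2
    obtain ⟨U, hU, V, hV, hUV⟩ := h2
    refine ⟨U, hU, V, hV, fun u hu v hv z h1 h3 => ?_⟩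
    obtain ⟨y, hy, hy'⟩ := hUV (Set.mk_mem_prod hu hv) ⟨z, h1, h3⟩
    obtain ⟨x, hx, hxy⟩ := Part.mem_bind_iff.1 hy
    obtain ⟨x', hx', hxy'⟩ := Part.mem_bind_iff.1 hy'
    rw [Part.mem_some_iff.1 hx] at hxy
    rw [Part.mem_some_iff.1 hx'] at hxy'
    exact ⟨y, hxy, hxy'⟩
  choose U hU V hV hUV using key
  let W : ∀ k, Set (G k).carrier := fun k => (⋂ l, U k l) ∩ ⋂ l, V l k
  have hW : ∀ k, W k ∈ (G k).filter := fun k =>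
    Filter.inter_mem (Filter.iInter_mem.2 (hU k)) (Filter.iInter_mem.2 fun l => hV l k)
  let r : X.carrier → Y.carrier → Prop := fun x y =>
    ∃ k, ∃ v ∈ W k, x ∈ (b k).toPFun v ∧ y ∈ (c k).toPFun v
  have r_unique : ∀ x y y', r x y → r x y' → y = y' := by
    rintro x y y' ⟨k, v, hv, hx, hy⟩ ⟨l, w, hw, hx', hy'⟩
    obtain ⟨z, hz, hz'⟩ := hUV k l v (Set.mem_iInter.1 hv.1 l) w (Set.mem_iInter.1 hw.2 k) x hx hx'
    rw [Part.mem_unique hy hz, Part.mem_unique hy' hz']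
  let d : X.carrier →. Y.carrier := fun x => ⟨∃ y, r x y, fun hx => hx.choose⟩
  have hd : ∀ x y, r x y → y ∈ d x := fun x y hxy =>
    ⟨⟨y, hxy⟩, r_unique x _ _ (Exists.choose_spec (⟨y, hxy⟩ : ∃ y, r x y)) hxy⟩
  let D : ContMap X Y :=
    { toPFun := d
      preimage_mem := fun A hA => by
        have h1 := hβ b hb (fun k => W k ∩ (c k).toPFun.preimage A) fun k =>
          Filter.inter_mem (hW k) ((c k).preimage_mem A hA)
        filter_upwards [h1]
        intro x hx
        obtain ⟨k, v, ⟨hv, y, hyA, hy⟩, hvx⟩ := Set.mem_iUnion.1 hx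
        exact ⟨y, hyA, hd x y ⟨k, v, hv, hvx, hy⟩⟩ }
  refine ⟨D.hom, fun k => ?_⟩
  rw [← hb k, ← hc k, ContMap.hom_comp, ContMap.hom_eq_iff]
  filter_upwards [hW k, (b k).preimage_mem _ Filter.univ_mem, (c k).preimage_mem _ Filter.univ_mem]
  rintro v hv ⟨x, -, hx⟩ ⟨y, -, hy⟩
  exact ⟨y, Part.mem_bind hx (hd x y ⟨k, v, hv, hx, hy⟩), hy⟩

/-- `K` is subcanonical. -/
theorem isSheaf_yoneda (Y : FSet.{u}) : Presieve.IsSheaf K (yoneda.obj Y) := by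
  rintro X R ⟨ι, _, G, β, hR, hβ⟩ x hx
  obtain ⟨δ, hδ⟩ := hβ.exists_glue (Y := Y) (fun k => x (β k) (hR k))
    fun k l P p q hpq => hx p q (hR k) (hR l) hpq
  refine ⟨δ, fun Z f hf => ?_, fun δ' hδ' => ?_⟩
  · obtain ⟨P, p, q, hpq, hp⟩ := exists_pullback_cover hβ f
    refine hp.hom_ext _ _ fun k => ?_
    calc p k ≫ f ≫ δ = q k ≫ β k ≫ δ := by rw [← Category.assoc, hpq, Category.assoc]
      _ = q k ≫ x (β k) (hR k) := by rw [hδ]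
      _ = p k ≫ x f hf := (hx (p k) (q k) hf (hR k) (hpq k)).symm
  · exact hβ.hom_ext _ _ fun k => (hδ' (β k) (hR k)).trans (hδ k).symm

end FSet

open FSet

/-- The nonstandard universe: the topos of sheaves on the category of filters for the topology
`K`. -/
abbrev NTopos := Sheaf FSet.K.{u} (Type u)

/-- The sheaf `yS`; its elements at a filter `F` are the morphisms from `F` to the simple filter
on `S`. -/
def yS (S : Type u) : NTopos.{u} :=
  ⟨yoneda.obj (simple S), (isSheaf_iff_isSheaf_of_type _ _).2 (isSheaf_yoneda _)⟩

/-- The constant object on `S` as a subobject of `yS`: the elements that take a finite number of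
values. -/
def deltaSub (S : Type u) : Subfunctor (yS S).obj where
  obj F := {α : F.unop ⟶ simple S | ∃ A : Set S, A.Finite ∧ A ∈ pushforward α}
  map := by
    rintro F G ⟨i⟩ α ⟨A, hA, hα⟩
    obtain ⟨a, rfl⟩ := exists_rep α
    refine ⟨A, hA, ?_⟩
    change A ∈ pushforward (i ≫ a.hom)
    obtain ⟨f, rfl⟩ := exists_rep i
    rw [mem_pushforward_comp_iff, ContMap.mem_pushforward]
    exact f.preimage_mem _ ((a.mem_pushforward A).1 hα)

theorem deltaSub_isSheaf (S : Type u) : Presieve.IsSheaf K (deltaSub S).toFunctor := by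
  refine ((deltaSub S).isSheaf_iff (isSheaf_yoneda _)).2 ?_
  rintro F α ⟨ι, _, G, β, hR, hβ⟩
  choose A hA hα using hR
  refine ⟨⋃ k, A k, Set.finite_iUnion hA, ?_⟩
  obtain ⟨a, rfl⟩ := exists_rep (X := F.unop) (Y := simple S) α
  rw [ContMap.mem_pushforward]
  refine (covers_iff β).1 hβ _ fun k => ?_
  rw [← mem_pushforward_comp_iff]
  exact Filter.mem_of_superset (hα k) (Set.subset_iUnion A k)

/-- The constant object on `S`. -/
def Delta (S : Type u) : NTopos.{u} :=
  ⟨(deltaSub S).toFunctor, (isSheaf_iff_isSheaf_of_type _ _).2 (deltaSub_isSheaf S)⟩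

/-! ## The language -/

/-- Types over a collection of base types, closed under finite sequences `σ*` and functions
`σ → τ`. -/
inductive Ty (B : Type v) : Type v
  | base : B → Ty B
  | star : Ty B → Ty B
  | arr : Ty B → Ty B → Ty B

/-- A many-sorted first-order language, given by its base types, function symbols (constants being
the nullary ones) and relation symbols. -/
structure Lang : Type (v + 1) where
  Base : Type v
  Fn : Type v
  fnDom : Fn → List (Ty Base)
  fnCod : Fn → Ty Base
  Rel : Type v
  relDom : Rel → List (Ty Base)

/-- The set denoted by a type. -/
def Ty.set {B : Type v} (b : B → Type u) : Ty B → Type u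
  | .base i => b i
  | .star σ => List (σ.set b)
  | .arr σ τ => σ.set b → τ.set b

/-- The product of the sets denoted by a list of types. -/
def Tup {B : Type v} (b : B → Type u) : List (Ty B) → Type u
  | [] => PUnit
  | σ :: Γ => σ.set b × Tup b Γ

/-- Function symbols of `L` together with application `f(x)` and finite sequence application
`s[x]`. Any further operation on finite sequences may be among the symbols of `L`. -/
inductive FnSymb (L : Lang.{v}) : List (Ty L.Base) → Ty L.Base → Type v
  | ofLang (f : L.Fn) : FnSymb L (L.fnDom f) (L.fnCod f)
  | app (σ τ : Ty L.Base) : FnSymb L [.arr σ τ, σ] τ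
  | seqApp (σ τ : Ty L.Base) : FnSymb L [.star (.arr σ (.star τ)), σ] (.star τ)

/-- Relation symbols of `L` together with equality and membership in a finite sequence. -/
inductive RelSymb (L : Lang.{v}) : List (Ty L.Base) → Type v
  | ofLang (r : L.Rel) : RelSymb L (L.relDom r)
  | eq (σ : Ty L.Base) : RelSymb L [σ, σ]
  | mem (σ : Ty L.Base) : RelSymb L [σ, .star σ]

/-- `Var Γ σ`: the (de Bruijn) variables of type `σ` in the context `Γ`. -/
inductive Var {B : Type v} : List (Ty B) → Ty B → Type v
  | zero {Γ : List (Ty B)} {σ : Ty B} : Var (σ :: Γ) σ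
  | succ {Γ : List (Ty B)} {σ τ : Ty B} : Var Γ σ → Var (τ :: Γ) σ

mutual
/-- Terms of type `σ` in the context `Γ`. -/
inductive Term (L : Lang.{v}) : List (Ty L.Base) → Ty L.Base → Type v
  | var {Γ : List (Ty L.Base)} {σ : Ty L.Base} : Var Γ σ → Term L Γ σ
  | fn {Γ Δ : List (Ty L.Base)} {σ : Ty L.Base} : FnSymb L Δ σ → Args L Γ Δ → Term L Γ σ
/-- Lists of terms in the context `Γ`, with types given by a list. -/
inductive Args (L : Lang.{v}) : List (Ty L.Base) → List (Ty L.Base) → Type v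
  | nil {Γ : List (Ty L.Base)} : Args L Γ []
  | cons {Γ Δ : List (Ty L.Base)} {σ : Ty L.Base} : Term L Γ σ → Args L Γ Δ → Args L Γ (σ :: Δ)
end

/-- Formulas, in the context `Γ`, of the language extended with the standardness predicates. -/
inductive Fml (L : Lang.{v}) : List (Ty L.Base) → Type v
  | rel {Γ Δ : List (Ty L.Base)} : RelSymb L Δ → Args L Γ Δ → Fml L Γ
  | st {Γ : List (Ty L.Base)} {σ : Ty L.Base} : Term L Γ σ → Fml L Γ
  | bot {Γ : List (Ty L.Base)} : Fml L Γ
  | and {Γ : List (Ty L.Base)} : Fml L Γ → Fml L Γ → Fml L Γ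
  | or {Γ : List (Ty L.Base)} : Fml L Γ → Fml L Γ → Fml L Γ
  | imp {Γ : List (Ty L.Base)} : Fml L Γ → Fml L Γ → Fml L Γ
  | all {Γ : List (Ty L.Base)} (σ : Ty L.Base) : Fml L (σ :: Γ) → Fml L Γ
  | ex {Γ : List (Ty L.Base)} (σ : Ty L.Base) : Fml L (σ :: Γ) → Fml L Γ

/-! ### Renaming of variables -/

/-- A renaming of the variables of `Γ` by variables of `Δ`. -/
def Ren {B : Type v} (Γ Δ : List (Ty B)) : Type v := ∀ σ : Ty B, Var Γ σ → Var Δ σ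

/-- Extension of a renaming under a binder. -/
def Ren.lift {B : Type v} {Γ Δ : List (Ty B)} (ρ : Ren Γ Δ) (τ : Ty B) :
    Ren (τ :: Γ) (τ :: Δ)
  | _, .zero => .zero
  | _, .succ x => .succ (ρ _ x)

mutual
/-- Renaming in terms. -/
def Term.rename {L : Lang.{v}} {Γ Δ : List (Ty L.Base)} (ρ : Ren Γ Δ) {σ : Ty L.Base} :
    Term L Γ σ → Term L Δ σ
  | .var x => .var (ρ _ x)
  | .fn f ts => .fn f (ts.rename ρ)
/-- Renaming in lists of terms. -/
def Args.rename {L : Lang.{v}} {Γ Δ : List (Ty L.Base)} (ρ : Ren Γ Δ) {Θ : List (Ty L.Base)} :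
    Args L Γ Θ → Args L Δ Θ
  | .nil => .nil
  | .cons t ts => .cons (t.rename ρ) (ts.rename ρ)
end

/-- Renaming of the free variables of a formula. -/
def Fml.rename {L : Lang.{v}} {Γ Δ : List (Ty L.Base)} (ρ : Ren Γ Δ) : Fml L Γ → Fml L Δ
  | .rel r ts => .rel r (ts.rename ρ)
  | .st t => .st (t.rename ρ)
  | .bot => .bot
  | .and Φ Ψ => .and (Φ.rename ρ) (Ψ.rename ρ)
  | .or Φ Ψ => .or (Φ.rename ρ) (Ψ.rename ρ)
  | .imp Φ Ψ => .imp (Φ.rename ρ) (Ψ.rename ρ)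
  | .all σ Φ => .all σ (Φ.rename (ρ.lift σ))
  | .ex σ Φ => .ex σ (Φ.rename (ρ.lift σ))

/-! ### External quantifiers, internal formulas, and the herbrandised axiom of choice -/

namespace Fml

variable {L : Lang.{v}}

/-- `∀ˢᵗ x : σ, Φ`, that is, `∀ x : σ, st x → Φ`. -/
def allSt {Γ : List (Ty L.Base)} (σ : Ty L.Base) (Φ : Fml L (σ :: Γ)) : Fml L Γ :=
  .all σ (.imp (.st (.var .zero)) Φ)

/-- `∃ˢᵗ x : σ, Φ`, that is, `∃ x : σ, st x ∧ Φ`. -/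
def exSt {Γ : List (Ty L.Base)} (σ : Ty L.Base) (Φ : Fml L (σ :: Γ)) : Fml L Γ :=
  .ex σ (.and (.st (.var .zero)) Φ)

/-- `∃ y ∈ t, Φ`, that is, `∃ y : τ, y ∈ t ∧ Φ`; here `t` is given in the context that already
contains `y`. -/
def exMem {Γ : List (Ty L.Base)} (τ : Ty L.Base) (t : Term L (τ :: Γ) (.star τ))
    (Φ : Fml L (τ :: Γ)) : Fml L Γ :=
  .ex τ (.and (.rel (.mem τ) (.cons (.var .zero) (.cons t .nil))) Φ)

/-- A formula is internal when it does not contain the standardness predicates. -/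
def Internal : {Γ : List (Ty L.Base)} → Fml L Γ → Prop
  | _, .rel _ _ => True
  | _, .st _ => False
  | _, .bot => True
  | _, .and Φ Ψ => Φ.Internal ∧ Ψ.Internal
  | _, .or Φ Ψ => Φ.Internal ∧ Ψ.Internal
  | _, .imp Φ Ψ => Φ.Internal ∧ Ψ.Internal
  | _, .all _ Φ => Φ.Internal
  | _, .ex _ Φ => Φ.Internal

/-- The renaming from the context `y, x, Γ` to the context `y, x, f, Γ`. -/
def skip {Γ : List (Ty L.Base)} (σ τ υ : Ty L.Base) : Ren (τ :: σ :: Γ) (τ :: σ :: υ :: Γ) :=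
  Ren.lift (Ren.lift (fun _ x => .succ x) σ) τ

/-- The premise `∀ˢᵗ x : σ, ∃ˢᵗ y : τ, Φ(x, y)`. -/
def hacPremise {Γ : List (Ty L.Base)} (σ τ : Ty L.Base) (Φ : Fml L (τ :: σ :: Γ)) : Fml L Γ :=
  allSt σ (exSt τ Φ)

/-- The conclusion `∃ˢᵗ f : σ → τ*, ∀ˢᵗ x : σ, ∃ y ∈ f(x), Φ(x, y)`. -/
def hacConclusion {Γ : List (Ty L.Base)} (σ τ : Ty L.Base) (Φ : Fml L (τ :: σ :: Γ)) : Fml L Γ :=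
  exSt (.arr σ (.star τ)) (allSt σ (exMem τ
    (.fn (.app σ (.star τ))
      (.cons (.var (.succ (.succ .zero))) (.cons (.var (.succ .zero)) .nil)))
    (Φ.rename (skip σ τ _))))

/-- The conclusion `∃ˢᵗ f : (σ → τ*)*, ∀ˢᵗ x : σ, ∃ y ∈ f[x], Φ(x, y)`. -/
def hacSeqConclusion {Γ : List (Ty L.Base)} (σ τ : Ty L.Base) (Φ : Fml L (τ :: σ :: Γ)) :
    Fml L Γ :=
  exSt (.star (.arr σ (.star τ))) (allSt σ (exMem τ
    (.fn (.seqApp σ τ)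
      (.cons (.var (.succ (.succ .zero))) (.cons (.var (.succ .zero)) .nil)))
    (Φ.rename (skip σ τ _))))

/-- The instance of the herbrandised axiom of choice for `Φ`, with `f : σ → τ*`. -/
def HAC {Γ : List (Ty L.Base)} (σ τ : Ty L.Base) (Φ : Fml L (τ :: σ :: Γ)) : Fml L Γ :=
  .imp (hacPremise σ τ Φ) (hacConclusion σ τ Φ)

/-- The instance of the herbrandised axiom of choice for `Φ`, with `f : (σ → τ*)*`. -/
def HACSeq {Γ : List (Ty L.Base)} (σ τ : Ty L.Base) (Φ : Fml L (τ :: σ :: Γ)) : Fml L Γ :=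
  .imp (hacPremise σ τ Φ) (hacSeqConclusion σ τ Φ)

end Fml

/-! ## Semantics -/

/-- An interpretation of the language in `Set`. -/
structure Interp (L : Lang.{v}) where
  base : L.Base → Type u
  fn : ∀ f : L.Fn, Tup base (L.fnDom f) → (L.fnCod f).set base
  rel : ∀ r : L.Rel, Tup base (L.relDom r) → Prop

namespace Interp

variable {L : Lang.{v}} (M : Interp.{u, v} L)

/-- The set denoted by a type. -/
abbrev El (σ : Ty L.Base) : Type u := σ.set M.base

/-- The product of the sets denoted by the types of a context. -/
abbrev Ctx (Γ : List (Ty L.Base)) : Type u := Tup M.base Γ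

/-- The interpretation of function symbols in `Set`; `s[x]` is the concatenation of the sequences
`s₀(x), s₁(x), …`. -/
def fnSymb : {Δ : List (Ty L.Base)} → {σ : Ty L.Base} → FnSymb L Δ σ → M.Ctx Δ → M.El σ
  | _, _, .ofLang f => M.fn f
  | _, _, .app σ τ => fun (a : (M.El σ → M.El τ) × M.El σ × PUnit) => a.1 a.2.1
  | _, _, .seqApp σ τ => fun (a : List (M.El σ → List (M.El τ)) × M.El σ × PUnit) =>
      (a.1.flatMap fun f => f a.2.1 : List (M.El τ))

/-- The interpretation of relation symbols in `Set`. -/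
def relSymb : {Δ : List (Ty L.Base)} → RelSymb L Δ → M.Ctx Δ → Prop
  | _, .ofLang r => M.rel r
  | _, .eq σ => fun (a : M.El σ × M.El σ × PUnit) => a.1 = a.2.1
  | _, .mem σ => fun (a : M.El σ × List (M.El σ) × PUnit) => a.1 ∈ a.2.1

/-- The projection given by a variable. -/
def proj : {Γ : List (Ty L.Base)} → {σ : Ty L.Base} → Var Γ σ → M.Ctx Γ → M.El σ
  | _, _, .zero => Prod.fst
  | _, _, .succ x => fun a => proj x a.2

mutual
/-- Value of a term in `Set`. -/
def valTerm {Γ : List (Ty L.Base)} (a : M.Ctx Γ) : {σ : Ty L.Base} → Term L Γ σ → M.El σ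
  | _, .var x => M.proj x a
  | _, .fn f ts => M.fnSymb f (valArgs a ts)
/-- Value of a list of terms in `Set`. -/
def valArgs {Γ : List (Ty L.Base)} (a : M.Ctx Γ) : {Δ : List (Ty L.Base)} → Args L Γ Δ → M.Ctx Δ
  | _, .nil => PUnit.unit
  | _, .cons t ts => (valTerm a t, valArgs a ts)
end

/-- Truth in `Set`. Only used for internal formulas; the clause for `st` plays no role. -/
def Sat : {Γ : List (Ty L.Base)} → Fml L Γ → M.Ctx Γ → Prop
  | _, .rel r ts, a => M.relSymb r (M.valArgs a ts)
  | _, .st _, _ => True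
  | _, .bot, _ => False
  | _, .and Φ Ψ, a => Sat Φ a ∧ Sat Ψ a
  | _, .or Φ Ψ, a => Sat Φ a ∨ Sat Ψ a
  | _, .imp Φ Ψ, a => Sat Φ a → Sat Ψ a
  | _, .all σ Φ, a => ∀ x : M.El σ, Sat Φ (x, a)
  | _, .ex σ Φ, a => ∃ x : M.El σ, Sat Φ (x, a)

mutual
/-- The interpretation `y⟦Γ⟧ ⟶ y⟦σ⟧` of a term in the nonstandard universe, as the morphism of
simple filters that represents it. A function symbol `f` is interpreted as `yf`. -/
def nTerm {Γ : List (Ty L.Base)} : {σ : Ty L.Base} → Term L Γ σ →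
    (simple (M.Ctx Γ) ⟶ simple (M.El σ))
  | _, .var x => simpleMap (M.proj x)
  | _, .fn f ts => nArgs ts ≫ simpleMap (M.fnSymb f)
/-- The interpretation of a list of terms in the nonstandard universe. -/
def nArgs {Γ : List (Ty L.Base)} : {Δ : List (Ty L.Base)} → Args L Γ Δ →
    (simple (M.Ctx Γ) ⟶ simple (M.Ctx Δ))
  | _, .nil => simpleMap fun _ => PUnit.unit
  | _, .cons t ts => pair (nTerm t) (nArgs ts)
end

/-- `Forces M Φ F α`, for an element `α` of `y⟦Γ⟧` at the filter `F`, is the forcing relation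
`F ⊩ Φ(α)` of first-order logic in the topos of sheaves for `K`. A relation symbol `R` is
interpreted as the subobject `yR`, and `st_σ` as the subobject `Δ⟦σ⟧` of `y⟦σ⟧`. -/
def Forces : {Γ : List (Ty L.Base)} → Fml L Γ → (F : FSet.{u}) → (F ⟶ simple (M.Ctx Γ)) → Prop
  | _, .rel r ts, F, α =>
      ∃ γ : F ⟶ simple {a // M.relSymb r a}, γ ≫ simpleMap Subtype.val = α ≫ M.nArgs ts
  | _, .st (σ := σ) t, F, α => (α ≫ M.nTerm t) ∈ (deltaSub (M.El σ)).obj (op F)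
  | _, .bot, F, _ => (⊥ : Sieve F) ∈ K F
  | _, .and Φ Ψ, F, α => Forces Φ F α ∧ Forces Ψ F α
  | _, .or Φ Ψ, F, α => ∃ R ∈ K F, ∀ (G : FSet.{u}) (β : G ⟶ F), R β →
      Forces Φ G (β ≫ α) ∨ Forces Ψ G (β ≫ α)
  | _, .imp Φ Ψ, F, α => ∀ (G : FSet.{u}) (β : G ⟶ F),
      Forces Φ G (β ≫ α) → Forces Ψ G (β ≫ α)
  | _, .all σ Φ, F, α => ∀ (G : FSet.{u}) (β : G ⟶ F) (x : G ⟶ simple (M.El σ)),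
      Forces Φ G (pair x (β ≫ α))
  | _, .ex σ Φ, F, α => ∃ R ∈ K F, ∀ (G : FSet.{u}) (β : G ⟶ F), R β →
      ∃ x : G ⟶ simple (M.El σ), Forces Φ G (pair x (β ≫ α))

/-- `Φ` holds in the nonstandard universe: it is forced at every filter, for all values of its free
variables. -/
def Holds {Γ : List (Ty L.Base)} (Φ : Fml L Γ) : Prop :=
  ∀ (F : FSet.{u}) (α : F ⟶ simple (M.Ctx Γ)), M.Forces Φ F α

end Interp

-- Image filters of morphisms into simple filters

namespace FSet

open Filter

-- Everything rests on one finiteness: covers are finite, and a standard element takes finitely many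
-- values. Suppose `F` forces the premise. For each actual `s : S` the constant `s` is standard, so
-- on some finite cover of `F` there are standard witnesses `y`. Finitely many pieces with finitely
-- many values each leave finitely many candidates in all (`exists_list_of_forces_exSt`), and choice
-- in the metatheory collects these lists into one function `f : S → T*`. The covers for different
-- `s` are unrelated, but this does no harm: a standard `x` over a restriction of `F` takes finitely
-- many values, so its domain is covered by pieces on which `x` is a constant `s`, and on each piece
-- the cover belonging to `s` can be pulled back (`exists_fun_of_forces_hacPremise`). As an element
-- of a set, `f` is itself standard, and so is the one-term sequence `[f]`. Only monotonicity of
-- forcing and invariance under renaming are used of Φ, so Φ may be external.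
--
-- The equivalences with truth in `Set` come from a theorem of Łoś type, `forces_iff_eventually`: an
-- internal formula is forced exactly when it is true of almost all values of its variables. Its
-- existential clause is the axiom of choice, its universal clause a generic element, its
-- disjunction clause a finite cover. To pass from the topos to `Set`, evaluate over the one-point
-- filter, find a proper filter in the covering sieve, and use that a statement true almost
-- everywhere over a proper filter has an instance. A standard `f` may have several values there;
-- concatenating the outputs of its finitely many candidates gives a single function, and this is
-- why the conclusion has sequences of candidates as values. From `Set` to the topos, compose `x`
-- with a choice function, which preserves finiteness of the set of values.

theorem pushforward_comp_simpleMap {X : FSet.{u}} {S T : Type u} (α : X ⟶ simple S) (f : S → T) :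
    pushforward (α ≫ simpleMap f) = (pushforward α).map f := by
  ext A
  rw [simpleMap, mem_pushforward_comp_iff, PFun.coe_preimage]
  rfl

/-- A morphism into a simple filter restricted along another morphism has a finer image filter. -/
theorem pushforward_comp_le {X Y : FSet.{u}} {S : Type u} (β : Y ⟶ X) (α : X ⟶ simple S) :
    pushforward (β ≫ α) ≤ pushforward α := by
  intro A hA
  obtain ⟨a, rfl⟩ := exists_rep α
  obtain ⟨b, rfl⟩ := exists_rep β
  rw [mem_pushforward_comp_iff, ContMap.mem_pushforward]
  exact b.preimage_mem _ ((a.mem_pushforward A).1 hA)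

/-- Image filters are determined locally. -/
theorem mem_pushforward_of_sieve {X : FSet.{u}} {S : Type u} {R : Sieve X} (hR : R ∈ K X)
    (α : X ⟶ simple S) (A : Set S)
    (h : ∀ (Y : FSet.{u}) (β : Y ⟶ X), R β → A ∈ pushforward (β ≫ α)) : A ∈ pushforward α := by
  obtain ⟨ι, _, G, β, hβR, hβ⟩ := hR
  obtain ⟨a, rfl⟩ := exists_rep α
  rw [ContMap.mem_pushforward]
  refine (covers_iff β).1 hβ _ fun k => ?_
  rw [← mem_pushforward_comp_iff]
  exact h _ _ (hβR k)

-- Functions and pairs as morphisms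

theorem simpleMap_comp {S T U : Type u} (f : S → T) (g : T → U) :
    simpleMap f ≫ simpleMap g = simpleMap (fun s => g (f s)) := by
  rw [simpleMap, simpleMap, ContMap.hom_comp, simpleMap, ContMap.hom_eq_iff]
  refine univ_mem' fun s => ⟨g (f s), Part.mem_bind (Part.mem_some _) (Part.mem_some _),
    Part.mem_some _⟩

theorem pair_simpleMap {S T U : Type u} (f : S → T) (g : S → U) :
    pair (simpleMap f) (simpleMap g) = simpleMap (fun s => (f s, g s)) := by
  refine (ContMap.hom_eq_iff _ _).2 (univ_mem' fun s => ⟨(f s, g s), ?_, Part.mem_some _⟩)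
  exact Part.mem_bind (Part.mem_some (f s)) (Part.mem_map _ (Part.mem_some (g s)))

theorem pair_fst {X : FSet.{u}} {S T : Type u} (α : X ⟶ simple S) (β : X ⟶ simple T) :
    pair α β ≫ simpleMap Prod.fst = α := by
  obtain ⟨f, rfl⟩ := exists_rep α
  obtain ⟨g, rfl⟩ := exists_rep β
  refine (ContMap.hom_eq_iff _ _).2 ?_
  filter_upwards [f.preimage_mem _ univ_mem, g.preimage_mem _ univ_mem]
  rintro u ⟨s, -, hs⟩ ⟨t, -, ht⟩
  exact ⟨s, Part.mem_bind (Part.mem_bind hs (Part.mem_map _ ht)) (Part.mem_some _), hs⟩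

theorem pair_snd {X : FSet.{u}} {S T : Type u} (α : X ⟶ simple S) (β : X ⟶ simple T) :
    pair α β ≫ simpleMap Prod.snd = β := by
  obtain ⟨f, rfl⟩ := exists_rep α
  obtain ⟨g, rfl⟩ := exists_rep β
  refine (ContMap.hom_eq_iff _ _).2 ?_
  filter_upwards [f.preimage_mem _ univ_mem, g.preimage_mem _ univ_mem]
  rintro u ⟨s, -, hs⟩ ⟨t, -, ht⟩
  exact ⟨t, Part.mem_bind (Part.mem_bind hs (Part.mem_map _ ht)) (Part.mem_some _), ht⟩

theorem eventually_pair_fst {X : FSet.{u}} {S T : Type u} {α : X ⟶ simple S} {p : S → Prop}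
    (h : ∀ᶠ s in pushforward α, p s) (β : X ⟶ simple T) :
    ∀ᶠ w in pushforward (pair α β), p w.1 := by
  rw [← pair_fst α β, pushforward_comp_simpleMap] at h
  exact h

theorem eventually_pair_snd {X : FSet.{u}} {S T : Type u} {β : X ⟶ simple T} {p : T → Prop}
    (h : ∀ᶠ t in pushforward β, p t) (α : X ⟶ simple S) :
    ∀ᶠ w in pushforward (pair α β), p w.2 := by
  rw [← pair_snd α β, pushforward_comp_simpleMap] at h
  exact h

theorem comp_pair {X Y : FSet.{u}} {S T : Type u} (γ : Y ⟶ X) (α : X ⟶ simple S)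
    (β : X ⟶ simple T) : γ ≫ pair α β = pair (γ ≫ α) (γ ≫ β) := by
  obtain ⟨f, rfl⟩ := exists_rep α
  obtain ⟨g, rfl⟩ := exists_rep β
  obtain ⟨c, rfl⟩ := exists_rep γ
  refine (ContMap.hom_eq_iff _ _).2 ?_
  filter_upwards [c.preimage_mem _ (f.preimage_mem _ univ_mem),
    c.preimage_mem _ (g.preimage_mem _ univ_mem)]
  rintro u ⟨x, ⟨s, -, hs⟩, hx⟩ ⟨x', ⟨t, -, ht⟩, hx'⟩
  obtain rfl := Part.mem_unique hx hx'
  exact ⟨(s, t), Part.mem_bind hx (Part.mem_bind hs (Part.mem_map _ ht)),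
    Part.mem_bind (Part.mem_bind hx hs) (Part.mem_map _ (Part.mem_bind hx ht))⟩

theorem pair_comp_simpleMap {X : FSet.{u}} {S T U : Type u} (q : X ⟶ simple S) (f : S → T)
    (g : S → U) :
    pair (q ≫ simpleMap f) (q ≫ simpleMap g) = q ≫ simpleMap (fun s => (f s, g s)) := by
  rw [← comp_pair, pair_simpleMap]

theorem pair_comp_map_snd {X : FSet.{u}} {S T U : Type u} (α : X ⟶ simple S) (β : X ⟶ simple T)
    (g : T → U) :
    pair α β ≫ simpleMap (fun w => (w.1, g w.2)) = pair α (β ≫ simpleMap g) := by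
  rw [← pair_comp_simpleMap _ Prod.fst (fun w => g w.2), ← simpleMap_comp Prod.snd g,
    ← Category.assoc, pair_fst, pair_snd]

-- Constants

/-- The constant morphism. -/
def const (X : FSet.{u}) {S : Type u} (s : S) : X ⟶ simple S :=
  ContMap.hom
    { toPFun := PFun.lift fun _ => s
      preimage_mem := fun V hV => by
        obtain rfl := mem_top.1 hV
        rw [PFun.coe_preimage]
        exact univ_mem }

theorem comp_const {X Y : FSet.{u}} {S : Type u} (β : Y ⟶ X) (s : S) :
    β ≫ const X s = const Y s := by
  obtain ⟨b, rfl⟩ := exists_rep β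
  refine (ContMap.hom_eq_iff _ _).2 ?_
  filter_upwards [b.preimage_mem _ univ_mem]
  rintro u ⟨x, -, hx⟩
  exact ⟨s, Part.mem_bind hx (Part.mem_some _), Part.mem_some _⟩

theorem mem_pushforward_const {X : FSet.{u}} {S : Type u} (s : S) :
    {s} ∈ pushforward (const X s) := by
  rw [const, ContMap.mem_pushforward, PFun.coe_preimage]
  exact univ_mem' fun _ => rfl

/-- This turns a standard element, restricted to where it has one given value, back into an element
of the set. -/
theorem eq_const {X : FSet.{u}} {S : Type u} (α : X ⟶ simple S) (s : S)
    (h : {s} ∈ pushforward α) : α = const X s := by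
  obtain ⟨a, rfl⟩ := exists_rep α
  rw [ContMap.mem_pushforward] at h
  refine (ContMap.hom_eq_iff _ _).2 ?_
  filter_upwards [h]
  rintro u ⟨_, rfl, hx⟩
  exact ⟨_, hx, Part.mem_some _⟩

-- Subsets, choice and generic elements

/-- A morphism into a simple filter factors through a subset exactly when the subset belongs to
its image filter. -/
theorem exists_lift_iff {X : FSet.{u}} {S : Type u} (p : S → Prop) (α : X ⟶ simple S) :
    (∃ γ : X ⟶ simple {s // p s}, γ ≫ simpleMap Subtype.val = α) ↔
      ∀ᶠ s in pushforward α, p s := by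
  constructor
  · rintro ⟨γ, rfl⟩
    rw [pushforward_comp_simpleMap, eventually_map]
    exact Eventually.of_forall Subtype.property
  · intro h
    obtain ⟨a, rfl⟩ := exists_rep α
    change {s | p s} ∈ _ at h
    rw [ContMap.mem_pushforward] at h
    -- The domain is cut down to the points whose value satisfies `p`; by `h` this is still a member
    -- of the filter.
    let g : ContMap X (simple {s // p s}) :=
      { toPFun := fun x => ⟨∃ hx : (a.toPFun x).Dom, p ((a.toPFun x).get hx),
          fun hx => ⟨(a.toPFun x).get hx.1, hx.2⟩⟩
        preimage_mem := fun V hV => by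
          obtain rfl := mem_top.1 hV
          filter_upwards [h]
          rintro x ⟨_, hs, hx, rfl⟩
          exact ⟨⟨_, hs⟩, trivial, ⟨hx, hs⟩, rfl⟩ }
    refine ⟨g.hom, (ContMap.hom_eq_iff _ _).2 ?_⟩
    filter_upwards [h]
    rintro x ⟨_, hs, hx, rfl⟩
    have hgx : (⟨_, hs⟩ : {s // p s}) ∈ g.toPFun x := ⟨⟨hx, hs⟩, rfl⟩
    exact ⟨_, Part.mem_bind hgx (Part.mem_some _), hx, rfl⟩

/-- The axiom of choice for elements of `yS`. -/
theorem exists_pair_of_eventually_exists {X : FSet.{u}} {S T : Type u} (p : S → T → Prop)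
    (α : X ⟶ simple T) (h : ∀ᶠ t in pushforward α, ∃ s, p s t) :
    ∃ σ : X ⟶ simple S, ∀ᶠ w in pushforward (pair σ α), p w.1 w.2 := by
  -- `S` may be empty, so there need not be a total choice function on `T`; factor first through the
  -- parameters that have a witness.
  obtain ⟨γ, rfl⟩ := (exists_lift_iff _ α).2 h
  refine ⟨γ ≫ simpleMap (fun t => t.2.choose), ?_⟩
  rw [pair_comp_simpleMap, pushforward_comp_simpleMap, eventually_map]
  exact Eventually.of_forall fun t => t.2.choose_spec

/-- The generic element of `yS` over a filter. -/
theorem exists_generic {X : FSet.{u}} {T : Type u} (S : Type u) (α : X ⟶ simple T) :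
    ∃ (Y : FSet.{u}) (β : Y ⟶ X) (σ : Y ⟶ simple S), ∀ p : S → T → Prop,
      (∀ᶠ w in pushforward (pair σ (β ≫ α)), p w.1 w.2) → ∀ᶠ t in pushforward α, ∀ s, p s t := by
  -- The filter does not constrain the second coordinate: each member contains a full cylinder `U ×
  -- S`, so what holds almost everywhere holds for every `s` over `U`.
  let Y : FSet.{u} := ⟨X.carrier × S, X.filter.comap Prod.fst⟩
  let b : ContMap Y X :=
    { toPFun := PFun.lift Prod.fst
      preimage_mem := fun V hV => by
        rw [PFun.coe_preimage]
        exact preimage_mem_comap hV }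
  let c : ContMap Y (simple S) :=
    { toPFun := PFun.lift Prod.snd
      preimage_mem := fun V hV => by
        obtain rfl := mem_top.1 hV
        rw [PFun.coe_preimage]
        exact univ_mem }
  refine ⟨Y, b.hom, c.hom, fun p h => ?_⟩
  obtain ⟨a, rfl⟩ := exists_rep α
  obtain ⟨U, hU, hUp⟩ := mem_comap.1 ((ContMap.mem_pushforward _ _).1 h)
  change {t | ∀ s, p s t} ∈ _
  rw [ContMap.mem_pushforward]
  filter_upwards [hU, a.preimage_mem _ univ_mem]
  rintro x hx ⟨t, -, ht⟩
  refine ⟨t, fun s => ?_, ht⟩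
  obtain ⟨⟨s', t'⟩, hp, hst⟩ := hUp (show (x, s) ∈ Prod.fst ⁻¹' U from hx)
  obtain ⟨s₁, hs₁, hst₁⟩ := Part.mem_bind_iff.1 hst
  obtain ⟨t₁, ht₁, heq⟩ := (Part.mem_map_iff _).1 hst₁
  obtain rfl := Part.mem_some_iff.1 hs₁
  obtain ⟨x₁, hx₁, hxt₁⟩ := Part.mem_bind_iff.1 ht₁
  obtain rfl := Part.mem_some_iff.1 hx₁
  obtain rfl := Part.mem_unique ht hxt₁
  cases heq
  exact hp

-- Restriction to a set of values and the resulting finite covers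

/-- The restriction of a filter to the inverse image of a subset. -/
theorem exists_restrict {X : FSet.{u}} {S : Type u} (α : X ⟶ simple S) (A : Set S) :
    ∃ (Y : FSet.{u}) (β : Y ⟶ X), pushforward (β ≫ α) = pushforward α ⊓ 𝓟 A ∧
      ∀ B : Set X.carrier, B ∈ pushforward β → ∃ a : ContMap X (simple S), a.hom = α ∧
        {x | x ∈ a.toPFun.preimage A → x ∈ B} ∈ X.filter := by
  obtain ⟨a, rfl⟩ := exists_rep α
  let Y : FSet.{u} := ⟨X.carrier, X.filter ⊓ 𝓟 (a.toPFun.preimage A)⟩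
  let b : ContMap Y X :=
    { toPFun := PFun.lift _root_.id
      preimage_mem := fun V hV => by
        rw [PFun.coe_preimage]
        exact mem_inf_of_left hV }
  refine ⟨Y, b.hom, ?_, fun B hB => ⟨a, rfl, ?_⟩⟩
  · ext B
    rw [mem_pushforward_comp_iff, mem_inf_principal, ContMap.mem_pushforward,
      ContMap.mem_pushforward]
    change PFun.preimage (PFun.lift _root_.id) _ ∈ X.filter ⊓ _ ↔ _
    rw [PFun.coe_preimage, mem_inf_principal]
    constructor
    · intro h
      filter_upwards [h, a.preimage_mem _ univ_mem]
      rintro x hx ⟨s, -, hs⟩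
      refine ⟨s, fun hsA => ?_, hs⟩
      obtain ⟨s', hs', hxs'⟩ := hx ⟨s, hsA, hs⟩
      exact Part.mem_unique hxs' hs ▸ hs'
    · intro h
      filter_upwards [h]
      rintro x ⟨s, hs, hxs⟩ ⟨s', hs', hxs'⟩
      exact ⟨s, hs (Part.mem_unique hxs' hxs ▸ hs'), hxs⟩
  · rw [ContMap.mem_pushforward] at hB
    change PFun.preimage (PFun.lift _root_.id) _ ∈ X.filter ⊓ _ at hB
    rw [PFun.coe_preimage, mem_inf_principal] at hB
    exact hB

/-- The restrictions to finitely many subsets that cover the values of a morphism generate a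
covering sieve. -/
theorem exists_sieve_of_finite {X : FSet.{u}} {S : Type u} (α : X ⟶ simple S) {ι : Type u}
    [Finite ι] (A : ι → Set S) (h : (⋃ i, A i) ∈ pushforward α) :
    ∃ R ∈ K X, ∀ (Y : FSet.{u}) (β : Y ⟶ X), R β → ∃ i, A i ∈ pushforward (β ≫ α) := by
  choose Y β hβ hB using fun i => exists_restrict α (A i)
  -- The families in the definition of `K` are indexed by types in the lowest universe, hence the
  -- passage to `Fin n`.
  obtain ⟨n, ⟨e⟩⟩ := Finite.exists_equiv_fin ι
  refine ⟨Sieve.generate (Presieve.ofArrows Y β), ⟨Fin n, inferInstance, fun k => Y (e.symm k),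
    fun k => β (e.symm k), fun k => Sieve.le_generate _ _ _ (Presieve.ofArrows.mk _),
    (covers_iff _).2 fun B hBk => ?_⟩, ?_⟩
  · obtain ⟨a₀, ha₀⟩ := exists_rep α
    rw [← ha₀, ContMap.mem_pushforward] at h
    -- Each `i` comes with its own representative of `α`; all are compared with `a₀`. Almost every
    -- point has its value in some `A i`, so these implications together put `B` in the filter.
    have key : ∀ i, {x | x ∈ a₀.toPFun.preimage (A i) → x ∈ B} ∈ X.filter := by
      intro i
      have := hBk (e i)
      rw [e.symm_apply_apply] at this
      obtain ⟨a, ha, haB⟩ := hB i B this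
      filter_upwards [haB, (ContMap.hom_eq_iff a a₀).1 (ha.trans ha₀.symm)]
      rintro x hx ⟨s, hs, hs'⟩ ⟨s₁, hs₁, hxs₁⟩
      obtain rfl := Part.mem_unique hs' hxs₁
      exact hx ⟨_, hs₁, hs⟩
    filter_upwards [h, iInter_mem.2 key]
    rintro x ⟨s, hs, hxs⟩ hx
    obtain ⟨i, hi⟩ := Set.mem_iUnion.1 hs
    exact Set.mem_iInter.1 hx i ⟨s, hi, hxs⟩
  · rintro Z _ ⟨W, γ, _, ⟨i⟩, rfl⟩
    refine ⟨i, ?_⟩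
    rw [Category.assoc]
    refine pushforward_comp_le γ _ ?_
    rw [hβ i]
    exact mem_inf_of_right (mem_principal_self _)

theorem comp_mem_deltaSub {X Y : FSet.{u}} {S : Type u} {α : X ⟶ simple S}
    (h : α ∈ (deltaSub S).obj (op X)) (β : Y ⟶ X) : β ≫ α ∈ (deltaSub S).obj (op Y) :=
  (deltaSub S).map β.op h

theorem const_mem_deltaSub (X : FSet.{u}) {S : Type u} (s : S) :
    const X s ∈ (deltaSub S).obj (op X) :=
  ⟨{s}, Set.finite_singleton s, mem_pushforward_const s⟩

end FSet

-- Terms, atomic formulas and monotonicity of forcing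

namespace Interp

open Filter

variable {L : Lang.{v}} (M : Interp.{u, v} L)

mutual
-- Functions are closed under composition and pairing inside the filter category, so terms keep
-- their meaning from `Set`.
theorem nTerm_eq {Γ : List (Ty L.Base)} : {σ : Ty L.Base} → (t : Term L Γ σ) →
    M.nTerm t = simpleMap fun a => M.valTerm a t
  | _, .var x => rfl
  | _, .fn f ts => by
    rw [nTerm, nArgs_eq ts, simpleMap_comp]
    rfl
theorem nArgs_eq {Γ : List (Ty L.Base)} : {Δ : List (Ty L.Base)} → (ts : Args L Γ Δ) →
    M.nArgs ts = simpleMap fun a => M.valArgs a ts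
  | _, .nil => rfl
  | _, .cons t ts => by
    rw [nArgs, nTerm_eq t, nArgs_eq ts]
    exact pair_simpleMap _ _
end

theorem forces_rel {Γ Δ : List (Ty L.Base)} (r : RelSymb L Δ) (ts : Args L Γ Δ) (F : FSet.{u})
    (α : F ⟶ simple (M.Ctx Γ)) :
    M.Forces (.rel r ts) F α ↔ ∀ᶠ a in pushforward α, M.relSymb r (M.valArgs a ts) := by
  rw [Forces, nArgs_eq, exists_lift_iff, pushforward_comp_simpleMap, eventually_map]

/-- The forcing relation is monotone. -/
theorem Forces.mono {M : Interp.{u, v} L} : {Γ : List (Ty L.Base)} → {Φ : Fml L Γ} →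
    {F G : FSet.{u}} → {α : F ⟶ simple (M.Ctx Γ)} → M.Forces Φ F α → (β : G ⟶ F) →
      M.Forces Φ G (β ≫ α)
  | _, .rel r ts, _, _, _, h, β => by
    obtain ⟨γ, hγ⟩ := h
    exact ⟨β ≫ γ, by rw [Category.assoc, hγ, Category.assoc]⟩
  | _, .st t, _, _, _, h, β => by
    rw [Forces, Category.assoc]
    exact comp_mem_deltaSub h β
  | _, .bot, _, _, _, h, β => by
    have := K.pullback_stable β h
    rwa [Sieve.pullback_bot] at this
  | _, .and _ _, _, _, _, h, β => ⟨h.1.mono β, h.2.mono β⟩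
  | _, .or Φ Ψ, _, _, _, h, β => by
    obtain ⟨R, hR, h⟩ := h
    refine ⟨R.pullback β, K.pullback_stable β hR, fun H γ hγ => ?_⟩
    rw [← Category.assoc]
    exact h H (γ ≫ β) hγ
  | _, .imp Φ Ψ, _, _, _, h, β => fun H γ => by
    rw [← Category.assoc]
    exact h H (γ ≫ β)
  | _, .all σ Φ, _, _, _, h, β => fun H γ x => by
    rw [← Category.assoc]
    exact h H (γ ≫ β) x
  | _, .ex σ Φ, _, _, _, h, β => by
    obtain ⟨R, hR, h⟩ := h
    refine ⟨R.pullback β, K.pullback_stable β hR, fun H γ hγ => ?_⟩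
    rw [← Category.assoc]
    exact h H (γ ≫ β) hγ

/-! ### Renaming -/

/-- The map of contexts given by a renaming. -/
def ren : {Γ Δ : List (Ty L.Base)} → Ren Γ Δ → M.Ctx Δ → M.Ctx Γ
  | [], _, _, _ => PUnit.unit
  | _ :: _, _, ρ, a => (M.proj (ρ _ .zero) a, ren (fun _ x => ρ _ (.succ x)) a)

theorem proj_ren : {Γ Δ : List (Ty L.Base)} → (ρ : Ren Γ Δ) → (a : M.Ctx Δ) →
    {σ : Ty L.Base} → (x : Var Γ σ) → M.proj x (M.ren ρ a) = M.proj (ρ _ x) a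
  | _, _, _, _, _, .zero => rfl
  | _, _, ρ, a, _, .succ x => proj_ren (fun _ x => ρ _ (.succ x)) a x

theorem ren_succ : {Γ Δ : List (Ty L.Base)} → (ρ : Ren Γ Δ) → {τ : Ty L.Base} →
    (a : M.El τ) → (b : M.Ctx Δ) →
    M.ren (Δ := τ :: Δ) (fun _ x => Var.succ (ρ _ x)) (a, b) = M.ren ρ b
  | [], _, _, _, _, _ => rfl
  | _ :: _, _, ρ, _, a, b => Prod.ext rfl (ren_succ (fun _ x => ρ _ (.succ x)) a b)

theorem ren_lift {Γ Δ : List (Ty L.Base)} (ρ : Ren Γ Δ) {τ : Ty L.Base} (a : M.El τ)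
    (b : M.Ctx Δ) : M.ren (ρ.lift τ) (a, b) = (a, M.ren ρ b) :=
  Prod.ext rfl (ren_succ M ρ a b)

theorem ren_id : {Γ : List (Ty L.Base)} → (a : M.Ctx Γ) → M.ren (fun _ x => x) a = a
  | [], _ => rfl
  | _ :: _, (a, b) => Prod.ext rfl ((ren_succ M (fun _ x => x) a b).trans (ren_id b))

mutual
theorem valTerm_rename {Γ Δ : List (Ty L.Base)} (ρ : Ren Γ Δ) (a : M.Ctx Δ) :
    {σ : Ty L.Base} → (t : Term L Γ σ) → M.valTerm a (t.rename ρ) = M.valTerm (M.ren ρ a) t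
  | _, .var x => (proj_ren M ρ a x).symm
  | _, .fn f ts => congrArg (M.fnSymb f) (valArgs_rename ρ a ts)
theorem valArgs_rename {Γ Δ : List (Ty L.Base)} (ρ : Ren Γ Δ) (a : M.Ctx Δ) :
    {Θ : List (Ty L.Base)} → (ts : Args L Γ Θ) →
      M.valArgs a (ts.rename ρ) = M.valArgs (M.ren ρ a) ts
  | _, .nil => rfl
  | _, .cons t ts => Prod.ext (valTerm_rename ρ a t) (valArgs_rename ρ a ts)
end

theorem sat_rename : {Γ Δ : List (Ty L.Base)} → (ρ : Ren Γ Δ) → (Φ : Fml L Γ) → (a : M.Ctx Δ) →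
    (M.Sat (Φ.rename ρ) a ↔ M.Sat Φ (M.ren ρ a))
  | _, _, ρ, .rel r ts, a => by
    rw [Fml.rename, Sat, Sat, valArgs_rename]
  | _, _, _, .st _, _ => Iff.rfl
  | _, _, _, .bot, _ => Iff.rfl
  | _, _, ρ, .and Φ Ψ, a => and_congr (sat_rename ρ Φ a) (sat_rename ρ Ψ a)
  | _, _, ρ, .or Φ Ψ, a => or_congr (sat_rename ρ Φ a) (sat_rename ρ Ψ a)
  | _, _, ρ, .imp Φ Ψ, a => imp_congr (sat_rename ρ Φ a) (sat_rename ρ Ψ a)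
  | _, _, ρ, .all σ Φ, a => forall_congr' fun x =>
    (sat_rename (ρ.lift σ) Φ _).trans (iff_of_eq (congrArg (M.Sat Φ) (ren_lift M ρ x a)))
  | _, _, ρ, .ex σ Φ, a => exists_congr fun x =>
    (sat_rename (ρ.lift σ) Φ _).trans (iff_of_eq (congrArg (M.Sat Φ) (ren_lift M ρ x a)))

theorem internal_rename : {Γ Δ : List (Ty L.Base)} → (ρ : Ren Γ Δ) → (Φ : Fml L Γ) →
    ((Φ.rename ρ).Internal ↔ Φ.Internal)
  | _, _, _, .rel _ _ => Iff.rfl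
  | _, _, _, .st _ => Iff.rfl
  | _, _, _, .bot => Iff.rfl
  | _, _, ρ, .and Φ Ψ => and_congr (internal_rename ρ Φ) (internal_rename ρ Ψ)
  | _, _, ρ, .or Φ Ψ => and_congr (internal_rename ρ Φ) (internal_rename ρ Ψ)
  | _, _, ρ, .imp Φ Ψ => and_congr (internal_rename ρ Φ) (internal_rename ρ Ψ)
  | _, _, ρ, .all σ Φ => internal_rename (ρ.lift σ) Φ
  | _, _, ρ, .ex σ Φ => internal_rename (ρ.lift σ) Φ

theorem pair_comp_ren_lift {Γ Δ : List (Ty L.Base)} (ρ : Ren Γ Δ) {τ : Ty L.Base} {F : FSet.{u}}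
    (x : F ⟶ simple (M.El τ)) (α : F ⟶ simple (M.Ctx Δ)) :
    pair x α ≫ simpleMap (S := M.Ctx (τ :: Δ)) (M.ren (ρ.lift τ)) =
      pair x (α ≫ simpleMap (M.ren ρ)) := by
  have h : (M.ren (ρ.lift τ) : M.Ctx (τ :: Δ) → M.Ctx (τ :: Γ)) =
      fun w : M.El τ × M.Ctx Δ => (w.1, M.ren ρ w.2) := funext fun w => ren_lift M ρ w.1 w.2
  rw [h]
  exact pair_comp_map_snd x α (M.ren ρ)

/-- The conclusion of the choice principle contains Φ in a context enlarged by `f`. As Φ may be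
external, the renaming has to be followed through forcing itself; `sat_rename` would not suffice. -/
theorem forces_rename : {Γ Δ : List (Ty L.Base)} → (ρ : Ren Γ Δ) → (Φ : Fml L Γ) →
    (F : FSet.{u}) → (α : F ⟶ simple (M.Ctx Δ)) →
    (M.Forces (Φ.rename ρ) F α ↔ M.Forces Φ F (α ≫ simpleMap (M.ren ρ)))
  | _, _, ρ, .rel r ts, F, α => by
    rw [Fml.rename, forces_rel, forces_rel, pushforward_comp_simpleMap, eventually_map]
    simp only [valArgs_rename]
  | _, _, ρ, .st t, F, α => by
    rw [Fml.rename, Forces, Forces, nTerm_eq, nTerm_eq, Category.assoc, simpleMap_comp]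
    simp only [valTerm_rename]
  | _, _, _, .bot, _, _ => Iff.rfl
  | _, _, ρ, .and Φ Ψ, F, α => and_congr (forces_rename ρ Φ F α) (forces_rename ρ Ψ F α)
  | _, _, ρ, .or Φ Ψ, F, α => exists_congr fun R => and_congr_right fun _ =>
    forall_congr' fun G => forall_congr' fun β => imp_congr_right fun _ => by
      rw [forces_rename ρ Φ, forces_rename ρ Ψ, Category.assoc]
  | _, _, ρ, .imp Φ Ψ, F, α => forall_congr' fun G => forall_congr' fun β => by
      rw [forces_rename ρ Φ, forces_rename ρ Ψ, Category.assoc]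
  | _, _, ρ, .all σ Φ, F, α => forall_congr' fun G => forall_congr' fun β =>
    forall_congr' fun x => by
      refine (forces_rename (ρ.lift σ) Φ G _).trans (iff_of_eq (congrArg (M.Forces Φ G) ?_))
      rw [← Category.assoc]
      exact pair_comp_ren_lift M ρ x (β ≫ α)
  | _, _, ρ, .ex σ Φ, F, α => exists_congr fun R => and_congr_right fun _ =>
    forall_congr' fun G => forall_congr' fun β => imp_congr_right fun _ =>
    exists_congr fun x => by
      refine (forces_rename (ρ.lift σ) Φ G _).trans (iff_of_eq (congrArg (M.Forces Φ G) ?_))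
      rw [← Category.assoc]
      exact pair_comp_ren_lift M ρ x (β ≫ α)

/-! ### Internal formulas -/

/-- The union of an empty family of images is the empty set. -/
theorem bot_mem_K_iff (F : FSet.{u}) : (⊥ : Sieve F) ∈ K F ↔ F.filter = ⊥ := by
  constructor
  · rintro ⟨ι, _, G, β, hβ, h⟩
    exact empty_mem_iff_bot.1 ((covers_iff β).1 h ∅ fun k => (hβ k).elim)
  · intro h
    exact ⟨Empty, inferInstance, fun k => k.elim, fun k => k.elim, fun k => k.elim,
      fun _ _ _ _ => by rw [h]; exact mem_bot⟩

theorem pushforward_eq_bot_iff {F : FSet.{u}} {S : Type u} (α : F ⟶ simple S) :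
    pushforward α = ⊥ ↔ F.filter = ⊥ := by
  obtain ⟨a, rfl⟩ := exists_rep α
  rw [← empty_mem_iff_bot, ← empty_mem_iff_bot, ContMap.mem_pushforward]
  constructor
  · intro h
    filter_upwards [h]
    rintro x ⟨_, h, _⟩
    exact h
  · intro h
    exact mem_of_superset h (Set.empty_subset _)

/-- An internal formula is forced exactly when it is true of almost all values of its free
variables. -/
theorem forces_iff_eventually : {Γ : List (Ty L.Base)} → (Φ : Fml L Γ) → Φ.Internal →
    (F : FSet.{u}) → (α : F ⟶ simple (M.Ctx Γ)) →
    (M.Forces Φ F α ↔ ∀ᶠ a in pushforward α, M.Sat Φ a)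
  | _, .rel r ts, _, F, α => forces_rel M r ts F α
  | _, .bot, _, F, α => by
    rw [Forces, bot_mem_K_iff, ← pushforward_eq_bot_iff α]
    exact eventually_false_iff_eq_bot.symm
  | _, .and Φ Ψ, h, F, α => by
    rw [Forces, forces_iff_eventually Φ h.1, forces_iff_eventually Ψ h.2, ← eventually_and]
    rfl
  | _, .or Φ Ψ, h, F, α => by
    simp only [Forces, forces_iff_eventually Φ h.1, forces_iff_eventually Ψ h.2]
    constructor
    · rintro ⟨R, hR, H⟩
      refine mem_pushforward_of_sieve hR α _ fun G β hβ => ?_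
      exact (H G β hβ).elim (fun h => h.mono fun _ => Or.inl) (fun h => h.mono fun _ => Or.inr)
    · intro H
      -- Split according to which disjunct the value satisfies; the two restrictions cover.
      obtain ⟨R, hR, hRβ⟩ := exists_sieve_of_finite α
        (fun i : ULift.{u} Bool => if i.down then {a | M.Sat Φ a} else {a | M.Sat Ψ a})
        (mem_of_superset H fun a ha => Set.mem_iUnion.2
          (ha.elim (fun h => ⟨⟨true⟩, h⟩) (fun h => ⟨⟨false⟩, h⟩)))
      refine ⟨R, hR, fun G β hβ => ?_⟩
      obtain ⟨⟨_ | _⟩, hi⟩ := hRβ G β hβ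
      · exact Or.inr hi
      · exact Or.inl hi
  | _, .imp Φ Ψ, h, F, α => by
    simp only [Forces, forces_iff_eventually Φ h.1, forces_iff_eventually Ψ h.2]
    constructor
    · intro H
      -- Test the implication on the restriction to the values that satisfy the antecedent.
      obtain ⟨G, β, hβ, -⟩ := exists_restrict α {a | M.Sat Φ a}
      have := H G β (by rw [hβ]; exact mem_inf_of_right (mem_principal_self _))
      rw [hβ] at this
      exact eventually_inf_principal.1 this
    · intro H G β hβ
      filter_upwards [hβ, pushforward_comp_le β α H] with a h1 h2 using h2 h1
  | _, .all σ Φ, h, F, α => by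
    constructor
    · intro H
      -- It is enough to test the generic element.
      obtain ⟨G, β, x, hx⟩ := exists_generic (M.El σ) α
      exact hx (fun s a => M.Sat Φ (s, a)) ((forces_iff_eventually Φ h G _).1 (H G β x))
    · intro H G β x
      exact (forces_iff_eventually Φ h G _).2
        ((eventually_pair_snd (pushforward_comp_le β α H) x).mono fun w hw => hw w.1)
  | _, .ex σ Φ, h, F, α => by
    constructor
    · rintro ⟨R, hR, H⟩
      refine mem_pushforward_of_sieve hR α _ fun G β hβ => ?_
      obtain ⟨x, hx⟩ := H G β hβ
      rw [← pair_snd x (β ≫ α), pushforward_comp_simpleMap]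
      exact ((forces_iff_eventually Φ h G _).1 hx).mono fun w hw => ⟨w.1, hw⟩
    · intro H
      -- Choice gives a witness without passing to a proper cover.
      refine ⟨⊤, K.top_mem F, fun G β _ => ?_⟩
      obtain ⟨x, hx⟩ := exists_pair_of_eventually_exists (fun s a => M.Sat Φ (s, a)) (β ≫ α)
        (pushforward_comp_le β α H)
      exact ⟨x, (forces_iff_eventually Φ h G _).2 hx⟩

/-! ### External quantifiers -/

/-- Extension of the values of the variables of a context by the value of a further variable. -/
def cons {Γ : List (Ty L.Base)} {σ : Ty L.Base} {F : FSet.{u}} (x : F ⟶ simple (M.El σ))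
    (α : F ⟶ simple (M.Ctx Γ)) : F ⟶ simple (M.Ctx (σ :: Γ)) :=
  pair x α

theorem comp_cons {Γ : List (Ty L.Base)} {σ : Ty L.Base} {F G : FSet.{u}} (β : G ⟶ F)
    (x : F ⟶ simple (M.El σ)) (α : F ⟶ simple (M.Ctx Γ)) :
    β ≫ M.cons x α = M.cons (β ≫ x) (β ≫ α) :=
  comp_pair β x α

theorem forces_st_zero {Γ : List (Ty L.Base)} {σ : Ty L.Base} {F : FSet.{u}}
    (x : F ⟶ simple (M.El σ)) (α : F ⟶ simple (M.Ctx Γ)) :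
    M.Forces (Γ := σ :: Γ) (.st (.var .zero)) F (M.cons x α) ↔
      x ∈ (deltaSub (M.El σ)).obj (op F) :=
  iff_of_eq (congrArg (· ∈ (deltaSub (M.El σ)).obj (op F)) (pair_fst x α))

/-- The quantifier and the implication each range over restrictions; the two ranges merge because
restrictions compose. -/
theorem forces_allSt {Γ : List (Ty L.Base)} {σ : Ty L.Base} (Φ : Fml L (σ :: Γ)) (F : FSet.{u})
    (α : F ⟶ simple (M.Ctx Γ)) :
    M.Forces (Fml.allSt σ Φ) F α ↔ ∀ (G : FSet.{u}) (β : G ⟶ F) (x : G ⟶ simple (M.El σ)),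
      x ∈ (deltaSub (M.El σ)).obj (op G) → M.Forces Φ G (M.cons x (β ≫ α)) := by
  constructor
  · intro h G β x hx
    have : M.Forces (.imp (.st (.var .zero)) Φ) G (M.cons x (β ≫ α)) := h G β x
    have := this G (𝟙 G)
    rw [Category.id_comp] at this
    exact this ((M.forces_st_zero _ _).2 hx)
  · intro h G β x H γ hx
    have e : γ ≫ M.cons x (β ≫ α) = M.cons (γ ≫ x) ((γ ≫ β) ≫ α) := by
      rw [comp_cons, Category.assoc]
    have e' : M.Forces (Γ := σ :: Γ) (.st (.var .zero)) H (M.cons (γ ≫ x) ((γ ≫ β) ≫ α)) :=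
      e ▸ hx
    exact (congrArg (M.Forces Φ H) e).mpr (h H (γ ≫ β) _ ((M.forces_st_zero _ _).1 e'))

theorem forces_exSt {Γ : List (Ty L.Base)} {σ : Ty L.Base} (Φ : Fml L (σ :: Γ)) (F : FSet.{u})
    (α : F ⟶ simple (M.Ctx Γ)) :
    M.Forces (Fml.exSt σ Φ) F α ↔ ∃ R ∈ K F, ∀ (G : FSet.{u}) (β : G ⟶ F), R β →
      ∃ x : G ⟶ simple (M.El σ), x ∈ (deltaSub (M.El σ)).obj (op G) ∧
        M.Forces Φ G (M.cons x (β ≫ α)) :=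
  exists_congr fun _ => and_congr_right fun _ => forall_congr' fun _ => forall_congr' fun _ =>
    imp_congr_right fun _ => exists_congr fun _ => and_congr_left fun _ => M.forces_st_zero _ _

/-- A constant is standard and restricts to the same constant, so it serves as one global witness.
-/
theorem forces_exSt_of_const {Γ : List (Ty L.Base)} {σ : Ty L.Base} {Φ : Fml L (σ :: Γ)}
    {F : FSet.{u}} {α : F ⟶ simple (M.Ctx Γ)} (s : M.El σ)
    (h : M.Forces Φ F (M.cons (const F s) α)) : M.Forces (Fml.exSt σ Φ) F α := by
  refine (M.forces_exSt Φ F α).2 ⟨⊤, K.top_mem F, fun G β _ =>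
    ⟨const G s, const_mem_deltaSub G s, ?_⟩⟩
  have := h.mono β
  rwa [comp_cons, comp_const] at this

/-! ### The herbrandised axiom of choice in the nonstandard universe -/

/-- A covering family of standard witnesses takes finitely many values altogether. -/
theorem exists_list_of_forces_exSt {Γ : List (Ty L.Base)} {τ : Ty L.Base} {Φ : Fml L (τ :: Γ)}
    {F : FSet.{u}} {α : F ⟶ simple (M.Ctx Γ)} (h : M.Forces (Fml.exSt τ Φ) F α) :
    ∃ l : List (M.El τ), ∃ R ∈ K F, ∀ (G : FSet.{u}) (β : G ⟶ F), R β →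
      ∃ y : G ⟶ simple (M.El τ), (∀ᶠ t in pushforward y, t ∈ l) ∧
        M.Forces Φ G (M.cons y (β ≫ α)) := by
  -- The sieve may contain infinitely many morphisms, with no common bound on the values of the
  -- witnesses. Witnesses are therefore chosen only on a finite covering family inside it and
  -- restricted from there.
  obtain ⟨R, ⟨ι, _, G, β, hβR, hβ⟩, hR⟩ := (M.forces_exSt Φ F α).1 h
  choose y hy hΦ using fun k => hR (G k) (β k) (hβR k)
  choose A hA hAy using hy
  refine ⟨(Set.finite_iUnion hA).toFinset.toList, Sieve.generate (Presieve.ofArrows G β),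
    ⟨ι, inferInstance, G, β, fun k => Sieve.le_generate _ _ _ (Presieve.ofArrows.mk k), hβ⟩, ?_⟩
  rintro H _ ⟨_, γ, _, ⟨k⟩, rfl⟩
  refine ⟨γ ≫ y k, ?_, ?_⟩
  · filter_upwards [pushforward_comp_le γ (y k) (hAy k)] with t ht
    rw [Finset.mem_toList, Set.Finite.mem_toFinset]
    exact Set.mem_iUnion.2 ⟨k, ht⟩
  · rw [Category.assoc, ← comp_cons]
    exact (hΦ k).mono γ

/-- The core of the argument: candidates are found for each constant `s`, and a standard `x` is
locally constant for a finite cover. The same `f` then serves all standard `x` over all restrictions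
of `F`. -/
theorem exists_fun_of_forces_hacPremise {Γ : List (Ty L.Base)} {σ τ : Ty L.Base}
    {Φ : Fml L (τ :: σ :: Γ)} {F : FSet.{u}} {α : F ⟶ simple (M.Ctx Γ)}
    (h : M.Forces (Fml.hacPremise σ τ Φ) F α) :
    ∃ f : M.El σ → List (M.El τ), ∀ (G : FSet.{u}) (β : G ⟶ F) (x : G ⟶ simple (M.El σ)),
      x ∈ (deltaSub (M.El σ)).obj (op G) → ∃ R ∈ K G, ∀ (H : FSet.{u}) (γ : H ⟶ G), R γ →
        ∃ y : H ⟶ simple (M.El τ), (∀ᶠ w in pushforward (pair y (γ ≫ x)), w.1 ∈ f w.2) ∧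
          M.Forces Φ H (M.cons y (γ ≫ M.cons x (β ≫ α))) := by
  -- The covering sieve `R s` depends on `s`; only the lists of candidates are collected into a
  -- function.
  choose f R hR hf using fun s : M.El σ => M.exists_list_of_forces_exSt
    ((M.forces_allSt _ F α).1 h F (𝟙 F) (const F s) (const_mem_deltaSub F s))
  refine ⟨f, fun G β x ⟨A, hA, hAx⟩ => ?_⟩
  have : Finite A := hA
  obtain ⟨R₀, hR₀, hR₀x⟩ := exists_sieve_of_finite x (fun a : A => {a.1})
    (by rwa [Set.iUnion_of_singleton_coe])
  let R' : Sieve G :=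
    { arrows := fun H γ => ∃ y : H ⟶ simple (M.El τ),
        (∀ᶠ w in pushforward (pair y (γ ≫ x)), w.1 ∈ f w.2) ∧
          M.Forces Φ H (M.cons y (γ ≫ M.cons x (β ≫ α)))
      downward_closed := by
        rintro H H' γ ⟨y, hy, hyΦ⟩ δ
        refine ⟨δ ≫ y, ?_, ?_⟩
        · rw [Category.assoc, ← comp_pair]
          exact pushforward_comp_le δ _ hy
        · rw [Category.assoc, ← comp_cons]
          exact hyΦ.mono δ }
  refine ⟨R', K.transitive hR₀ R' fun H γ hγ => ?_, fun H γ hγ => hγ⟩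
  obtain ⟨⟨s, _⟩, hs⟩ := hR₀x H γ hγ
  replace hs := eq_const _ s hs
  -- On this piece `x` is the constant `s`, so the cover chosen for `s` over `F`, pulled back,
  -- supplies the witnesses.
  refine K.superset_covering ?_ (K.pullback_stable (γ ≫ β) (hR s))
  intro J δ hδ
  obtain ⟨y, hy, hyΦ⟩ := hf s J (δ ≫ γ ≫ β) hδ
  have hx : (δ ≫ γ) ≫ x = const J s := by rw [Category.assoc, hs, comp_const]
  refine ⟨y, ?_, ?_⟩
  · rw [hx]
    filter_upwards [eventually_pair_fst hy (const J s),
      eventually_pair_snd (mem_pushforward_const s) y] with w h1 h2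
    rw [show w.2 = s from h2]
    exact h1
  · rw [comp_cons, hx]
    rw [comp_cons, comp_const, Category.id_comp] at hyΦ
    simpa only [Category.assoc] using hyΦ

theorem ren_skip {Γ : List (Ty L.Base)} (σ τ υ : Ty L.Base) (y : M.El τ) (x : M.El σ)
    (f : M.El υ) (a : M.Ctx Γ) : M.ren (Fml.skip σ τ υ) (y, x, f, a) = (y, x, a) := by
  refine (M.ren_lift _ _ _).trans (Prod.ext rfl ((M.ren_lift _ _ _).trans (Prod.ext rfl ?_)))
  exact (M.ren_succ (fun _ x => x) f a).trans (M.ren_id a)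

theorem forces_rename_skip {Γ : List (Ty L.Base)} {σ τ υ : Ty L.Base} (Φ : Fml L (τ :: σ :: Γ))
    {F : FSet.{u}} (y : F ⟶ simple (M.El τ)) (x : F ⟶ simple (M.El σ)) (f : F ⟶ simple (M.El υ))
    (α : F ⟶ simple (M.Ctx Γ)) :
    M.Forces (Φ.rename (Fml.skip σ τ υ)) F (M.cons y (M.cons x (M.cons f α))) ↔
      M.Forces Φ F (M.cons y (M.cons x α)) := by
  refine (M.forces_rename (Fml.skip σ τ υ) Φ F _).trans (iff_of_eq (congrArg (M.Forces Φ F) ?_))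
  have h : (M.ren (Fml.skip σ τ υ) : M.Ctx (τ :: σ :: υ :: Γ) → M.Ctx (τ :: σ :: Γ)) =
      fun w : M.El τ × M.El σ × M.El υ × M.Ctx Γ => (w.1, w.2.1, w.2.2.2) :=
    funext fun w => M.ren_skip σ τ υ w.1 w.2.1 w.2.2.1 w.2.2.2
  rw [h]
  refine (pair_comp_map_snd y (pair x (M.cons f α)) fun w => (w.1, w.2.2)).trans ?_
  exact congrArg (pair y) ((pair_comp_map_snd x (pair f α) Prod.snd).trans
    (congrArg (pair x) (pair_snd f α)))

/-- A constant herbrandised choice function `c`, with values computed by a term `t`, witnesses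
`∃ˢᵗ f, ∀ˢᵗ x, ∃ y ∈ t(f, x), Φ(x, y)`. -/
theorem forces_exSt_allSt_exMem {Γ : List (Ty L.Base)} {σ τ υ : Ty L.Base}
    {Φ : Fml L (τ :: σ :: Γ)} {F : FSet.{u}} {α : F ⟶ simple (M.Ctx Γ)}
    (t : Term L (τ :: σ :: υ :: Γ) (.star τ)) (f : M.El σ → List (M.El τ)) (c : M.El υ)
    (ht : ∀ (y : M.El τ) (x : M.El σ) (a : M.Ctx Γ),
      y ∈ f x → M.relSymb (.mem τ) (y, M.valTerm (Γ := τ :: σ :: υ :: Γ) (y, x, c, a) t, PUnit.unit))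
    (hf : ∀ (G : FSet.{u}) (β : G ⟶ F) (x : G ⟶ simple (M.El σ)),
      x ∈ (deltaSub (M.El σ)).obj (op G) → ∃ R ∈ K G, ∀ (H : FSet.{u}) (γ : H ⟶ G), R γ →
        ∃ y : H ⟶ simple (M.El τ), (∀ᶠ w in pushforward (pair y (γ ≫ x)), w.1 ∈ f w.2) ∧
          M.Forces Φ H (M.cons y (γ ≫ M.cons x (β ≫ α)))) :
    M.Forces (Fml.exSt υ (Fml.allSt σ (Fml.exMem τ t (Φ.rename (Fml.skip σ τ υ))))) F α := by
  refine M.forces_exSt_of_const c ((M.forces_allSt _ F _).2 fun G β x hx => ?_)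
  obtain ⟨R, hR, h⟩ := hf G β x hx
  refine ⟨R, hR, fun H γ hγ => ?_⟩
  obtain ⟨y, hy, hyΦ⟩ := h H γ hγ
  have e : γ ≫ M.cons x (β ≫ M.cons (const F c) α) =
      M.cons (γ ≫ x) (M.cons (const H c) (γ ≫ β ≫ α)) := by
    rw [comp_cons, comp_cons, comp_const, comp_cons, comp_const]
  refine ⟨y, ?_⟩
  have : M.Forces (Fml.and (.rel (.mem τ) (.cons (.var .zero) (.cons t .nil)))
      (Φ.rename (Fml.skip σ τ υ))) H
      (M.cons y (M.cons (γ ≫ x) (M.cons (const H c) (γ ≫ β ≫ α)))) := by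
    refine ⟨(M.forces_rel _ _ _ _).2 ?_, (M.forces_rename_skip Φ _ _ _ _).2 ?_⟩
    -- The bound on `y` concerns only the values of `y` and `x`; it is pulled back along the
    -- projection that forgets the rest of the context.
    · have h1 : ∀ᶠ w in pushforward (pair y (pair (γ ≫ x) (pair (const H c) (γ ≫ β ≫ α)))),
          w.1 ∈ f w.2.1 := by
        have := pair_comp_map_snd y (pair (γ ≫ x) (pair (const H c) (γ ≫ β ≫ α))) Prod.fst
        rw [pair_fst] at this
        rw [← this, pushforward_comp_simpleMap] at hy
        exact hy
      have h2 : ∀ᶠ w in pushforward (pair y (pair (γ ≫ x) (pair (const H c) (γ ≫ β ≫ α)))),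
          w.2.2.1 = c :=
        eventually_pair_snd (eventually_pair_snd
          (eventually_pair_fst (mem_pushforward_const c) _) _) _
      filter_upwards [h1, h2]
      rintro ⟨y, x, c', a⟩ hw rfl
      exact ht y x a hw
    · rwa [comp_cons] at hyΦ
  rw [← e] at this
  exact this

theorem holds_HAC {Γ : List (Ty L.Base)} (σ τ : Ty L.Base) (Φ : Fml L (τ :: σ :: Γ)) :
    M.Holds (Fml.HAC σ τ Φ) := by
  intro F α G β h
  obtain ⟨f, hf⟩ := M.exists_fun_of_forces_hacPremise h
  exact M.forces_exSt_allSt_exMem _ f f (fun _ _ _ h => h) hf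

theorem holds_HACSeq {Γ : List (Ty L.Base)} (σ τ : Ty L.Base) (Φ : Fml L (τ :: σ :: Γ)) :
    M.Holds (Fml.HACSeq σ τ Φ) := by
  intro F α G β h
  obtain ⟨f, hf⟩ := M.exists_fun_of_forces_hacPremise h
  -- Application of the one-term sequence `[f]` to `x` gives `f x`.
  exact M.forces_exSt_allSt_exMem _ f [f]
    (fun _ x _ h => List.mem_flatMap.2 ⟨f, List.mem_singleton_self f, h⟩) hf

/-! ### Transfer -/

/-- Closed formulas are evaluated over this filter, which is proper even when types of the language
are empty. -/
theorem simple_punit_neBot : (simple PUnit.{u + 1}).filter.NeBot :=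
  ⟨(top_ne_bot : (⊤ : Filter PUnit.{u + 1}) ≠ ⊥)⟩

/-- A covering sieve of a proper filter contains a morphism from a proper filter. -/
theorem exists_neBot_of_sieve {F : FSet.{u}} (hF : F.filter.NeBot) {R : Sieve F} (hR : R ∈ K F) :
    ∃ (G : FSet.{u}) (β : G ⟶ F), G.filter.NeBot ∧ R β := by
  by_contra! hcon
  -- If only improper filters occurred in the sieve, the empty set would belong to the image filter
  -- locally, hence globally.
  refine hF.ne ((pushforward_eq_bot_iff (const F PUnit.unit)).1 (empty_mem_iff_bot.1 ?_))
  refine mem_pushforward_of_sieve hR _ _ fun G β hβ => ?_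
  rw [empty_mem_iff_bot, pushforward_eq_bot_iff]
  by_contra hG
  exact hcon G β ⟨hG⟩ hβ

theorem pushforward_neBot {F : FSet.{u}} (hF : F.filter.NeBot) {S : Type u} (α : F ⟶ simple S) :
    (pushforward α).NeBot :=
  ⟨fun h => hF.ne ((pushforward_eq_bot_iff α).1 h)⟩

/-- A choice function for an internal formula in `Set` gives witnesses in the nonstandard
universe. -/
theorem forces_cons_comp_simpleMap {σ τ : Ty L.Base} {φ : Fml L [τ, σ]} (hφ : φ.Internal)
    {g : M.El σ → M.El τ} (hg : ∀ x, M.Sat φ (g x, x, PUnit.unit)) {F : FSet.{u}}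
    (x : F ⟶ simple (M.El σ)) (α : F ⟶ simple (M.Ctx [])) :
    M.Forces φ F (M.cons (x ≫ simpleMap g) (M.cons x α)) := by
  refine (M.forces_iff_eventually φ hφ F _).2 ?_
  have e : pair (x ≫ simpleMap g) (pair x α) =
      pair x α ≫ simpleMap (fun w : M.El σ × M.Ctx [] => (g w.1, w)) := by
    rw [← pair_comp_simpleMap (S := M.El σ × M.Ctx []) _ (fun w => g w.1) (fun w => w),
      ← simpleMap_comp Prod.fst g, ← Category.assoc, pair_fst]
    exact congrArg _ (Category.comp_id _).symm
  have h : ∀ᶠ w : M.El τ × M.El σ × M.Ctx [] in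
      pushforward (pair (x ≫ simpleMap g) (pair x α)), M.Sat φ w := by
    rw [e, pushforward_comp_simpleMap]
    exact eventually_map.2 (Eventually.of_forall fun w => hg w.1)
  exact h

theorem holds_hacPremise_iff {σ τ : Ty L.Base} {φ : Fml L [τ, σ]} (hφ : φ.Internal) :
    M.Holds (Fml.hacPremise σ τ φ) ↔
      ∀ x : M.El σ, ∃ y : M.El τ, M.Sat φ (y, x, PUnit.unit) := by
  constructor
  · intro h s
    let F : FSet.{u} := simple PUnit
    obtain ⟨α⟩ : Nonempty (F ⟶ simple (M.Ctx [])) := ⟨const F PUnit.unit⟩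
    obtain ⟨R, hR, H⟩ := (M.forces_exSt _ _ _).1 ((M.forces_allSt _ F _).1
      (h F α) F (𝟙 F) (const F s) (const_mem_deltaSub F s))
    -- Over an improper filter forcing carries no information. Over a proper one, almost every value
    -- of `y` is a true witness, so there is one.
    obtain ⟨G, β, hG, hβ⟩ := exists_neBot_of_sieve simple_punit_neBot hR
    obtain ⟨y, -, hy⟩ := H G β hβ
    rw [comp_cons, comp_const] at hy
    have := pushforward_neBot hG (M.cons y (M.cons (const G s) (β ≫ 𝟙 F ≫ α)))
    obtain ⟨⟨y, x, ⟨⟩⟩, hyx, hx⟩ := (((M.forces_iff_eventually φ hφ G _).1 hy).and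
      (eventually_pair_snd (eventually_pair_fst (mem_pushforward_const s) _) y)).exists
    obtain rfl : x = s := hx
    exact ⟨y, hyx⟩
  · intro h F α
    choose g hg using h
    refine (M.forces_allSt _ F α).2 fun G β x ⟨A, hA, hAx⟩ => (M.forces_exSt _ _ _).2
      ⟨⊤, K.top_mem G, fun H γ _ => ⟨(γ ≫ x) ≫ simpleMap g, ?_, ?_⟩⟩
    -- The witness `g ∘ x` is standard because `x` takes finitely many values.
    · refine ⟨g '' A, hA.image g, ?_⟩
      rw [pushforward_comp_simpleMap]
      exact image_mem_map (pushforward_comp_le γ x hAx)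
    · rw [comp_cons]
      exact M.forces_cons_comp_simpleMap hφ hg _ _

/-- Transfer for `∃ˢᵗ f, ∀ˢᵗ x, ∃ y ∈ t(f, x), φ(x, y)`: the finitely many values of a standard
witness `f` over a proper filter are combined into one function by concatenation. -/
theorem exists_of_holds_exSt_allSt_exMem {σ τ υ : Ty L.Base} {φ : Fml L [τ, σ]}
    (hφ : φ.Internal) (t : Term L [τ, σ, υ] (.star τ)) (g : M.El υ → M.El σ → List (M.El τ))
    (ht : ∀ (y : M.El τ) (x : M.El σ) (c : M.El υ),
      M.relSymb (.mem τ) (y, M.valTerm (Γ := [τ, σ, υ]) (y, x, c, PUnit.unit) t, PUnit.unit) →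
        y ∈ g c x)
    (h : M.Holds (Fml.exSt υ (Fml.allSt σ (Fml.exMem τ t (φ.rename (Fml.skip σ τ υ)))))) :
    ∃ f : M.El σ → List (M.El τ), ∀ x : M.El σ, ∃ y ∈ f x, M.Sat φ (y, x, PUnit.unit) := by
  let F : FSet.{u} := simple PUnit
  obtain ⟨α⟩ : Nonempty (F ⟶ simple (M.Ctx [])) := ⟨const F PUnit.unit⟩
  obtain ⟨l, R, hR, H⟩ := M.exists_list_of_forces_exSt (h F α)
  obtain ⟨G, β, hG, hβ⟩ := exists_neBot_of_sieve simple_punit_neBot hR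
  obtain ⟨c, hl, hc⟩ := H G β hβ
  -- `G`, `c` and `l` are fixed before `x`, but the value of `c` that works may depend on `x`; hence
  -- all candidates in `l` are concatenated.
  refine ⟨fun x => l.flatMap fun c => g c x, fun x => ?_⟩
  have hx := (M.forces_allSt _ G _).1 hc G (𝟙 G) (const G x) (const_mem_deltaSub G x)
  rw [Category.id_comp] at hx
  -- With the two external quantifiers removed, what is left is internal, and forcing reduces to
  -- truth almost everywhere.
  have hint : (Fml.exMem τ t (φ.rename (Fml.skip σ τ υ))).Internal :=
    ⟨trivial, (internal_rename _ φ).2 hφ⟩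
  have := pushforward_neBot hG (M.cons (const G x) (M.cons c (β ≫ α)))
  obtain ⟨⟨x', c', ⟨⟩⟩, ⟨y, hyt, hy⟩, hx', hc'⟩ :=
    (((M.forces_iff_eventually _ hint G _).1 hx).and
      ((eventually_pair_fst (mem_pushforward_const x) (M.cons c (β ≫ α))).and
        (eventually_pair_snd (eventually_pair_fst hl (β ≫ α)) (const G x)))).exists
  obtain rfl : x' = x := hx'
  refine ⟨y, List.mem_flatMap.2 ⟨c', hc', ht y x' c' hyt⟩, ?_⟩
  exact (congrArg (M.Sat φ) (M.ren_skip (Γ := []) σ τ υ y x' c' PUnit.unit)).mp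
    ((M.sat_rename (Fml.skip σ τ υ) φ _).1 hy)

/-- Here `c` encodes `f` as a constant; a function `g` selecting a correct entry of each list `f x`
supplies the witness `g ∘ x`. -/
theorem holds_exSt_allSt_exMem_of_exists {σ τ υ : Ty L.Base} {φ : Fml L [τ, σ]}
    (hφ : φ.Internal) (t : Term L [τ, σ, υ] (.star τ)) (f : M.El σ → List (M.El τ)) (c : M.El υ)
    (ht : ∀ (y : M.El τ) (x : M.El σ),
      y ∈ f x → M.relSymb (.mem τ)
        (y, M.valTerm (Γ := [τ, σ, υ]) (y, x, c, PUnit.unit) t, PUnit.unit))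
    (hf : ∀ x : M.El σ, ∃ y ∈ f x, M.Sat φ (y, x, PUnit.unit)) :
    M.Holds (Fml.exSt υ (Fml.allSt σ (Fml.exMem τ t (φ.rename (Fml.skip σ τ υ))))) := by
  intro F α
  choose g hgf hg using hf
  refine M.forces_exSt_allSt_exMem t f c (fun y x _ => ht y x) fun G β x hx =>
    ⟨⊤, K.top_mem G, fun H γ _ => ⟨(γ ≫ x) ≫ simpleMap g, ?_, ?_⟩⟩
  · have e : pair ((γ ≫ x) ≫ simpleMap g) (γ ≫ x) = (γ ≫ x) ≫ simpleMap (fun s => (g s, s)) := by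
      rw [← pair_comp_simpleMap _ g (fun w => w)]
      exact congrArg _ (Category.comp_id _).symm
    rw [e, pushforward_comp_simpleMap, eventually_map]
    exact Eventually.of_forall hgf
  · rw [comp_cons]
    exact M.forces_cons_comp_simpleMap hφ hg _ _

theorem holds_hacConclusion_iff {σ τ : Ty L.Base} {φ : Fml L [τ, σ]} (hφ : φ.Internal) :
    M.Holds (Fml.hacConclusion σ τ φ) ↔
      ∃ f : M.El σ → List (M.El τ), ∀ x : M.El σ, ∃ y ∈ f x, M.Sat φ (y, x, PUnit.unit) :=
  ⟨M.exists_of_holds_exSt_allSt_exMem hφ _ (fun c => c) fun _ _ _ h => h,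
    fun ⟨f, hf⟩ => M.holds_exSt_allSt_exMem_of_exists hφ _ f f (fun _ _ h => h) hf⟩

/-- A sequence of functions collapses to one function by pointwise concatenation, and one function
is a one-term sequence; thus both versions have the same meaning in `Set`. -/
theorem holds_hacSeqConclusion_iff {σ τ : Ty L.Base} {φ : Fml L [τ, σ]} (hφ : φ.Internal) :
    M.Holds (Fml.hacSeqConclusion σ τ φ) ↔
      ∃ f : M.El σ → List (M.El τ), ∀ x : M.El σ, ∃ y ∈ f x, M.Sat φ (y, x, PUnit.unit) :=
  ⟨M.exists_of_holds_exSt_allSt_exMem hφ _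
      (fun (c : List (M.El σ → List (M.El τ))) x => c.flatMap fun f : M.El σ → List (M.El τ) => f x) (fun _ _ _ h => h),
    fun ⟨f, hf⟩ => M.holds_exSt_allSt_exMem_of_exists hφ _ f [f]
      (fun _ _ h => List.mem_flatMap.2 ⟨f, List.mem_singleton_self f, h⟩) hf⟩

theorem Holds.mp {M : Interp.{u, v} L} {Γ : List (Ty L.Base)} {Φ Ψ : Fml L Γ}
    (h : M.Holds (.imp Φ Ψ)) (hΦ : M.Holds Φ) : M.Holds Ψ := by
  intro F α
  have := h F α F (𝟙 F) (hΦ F _)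
  rwa [Category.id_comp] at this

end Interp

theorem mainTheorem7 (L : Lang.{v}) (M : Interp.{u, v} L) :
    (∀ (Γ : List (Ty L.Base)) (σ τ : Ty L.Base) (Φ : Fml L (τ :: σ :: Γ)),
      M.Holds (Fml.HAC σ τ Φ) ∧ M.Holds (Fml.HACSeq σ τ Φ)) ∧
    (∀ (σ τ : Ty L.Base) (φ : Fml L [τ, σ]), φ.Internal →
      (M.Holds (Fml.hacPremise σ τ φ) ↔
        ∀ x : M.El σ, ∃ y : M.El τ, M.Sat φ (y, x, PUnit.unit)) ∧
      (M.Holds (Fml.hacConclusion σ τ φ) ↔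
        ∃ f : M.El σ → List (M.El τ), ∀ x : M.El σ, ∃ y ∈ f x, M.Sat φ (y, x, PUnit.unit)) ∧
      (M.Holds (Fml.hacSeqConclusion σ τ φ) ↔
        ∃ f : M.El σ → List (M.El τ), ∀ x : M.El σ, ∃ y ∈ f x, M.Sat φ (y, x, PUnit.unit)) ∧
      ((M.Holds (Fml.HAC σ τ φ) ∨ M.Holds (Fml.HACSeq σ τ φ)) →
        (∀ x : M.El σ, ∃ y : M.El τ, M.Sat φ (y, x, PUnit.unit)) →
        ∃ f : M.El σ → List (M.El τ), ∀ x : M.El σ, ∃ y ∈ f x,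
          M.Sat φ (y, x, PUnit.unit))) := by
  refine ⟨fun Γ σ τ Φ => ⟨M.holds_HAC σ τ Φ, M.holds_HACSeq σ τ Φ⟩, fun σ τ φ hφ =>
    ⟨M.holds_hacPremise_iff hφ, M.holds_hacConclusion_iff hφ, M.holds_hacSeqConclusion_iff hφ, ?_⟩⟩
  -- The premise transfers from `Set` to the topos, the assumed instance yields the conclusion
  -- there, and this transfers back.
  rintro (h | h) hS
  · exact (M.holds_hacConclusion_iff hφ).1 (h.mp ((M.holds_hacPremise_iff hφ).2 hS))
  · exact (M.holds_hacSeqConclusion_iff hφ).1 (h.mp ((M.holds_hacPremise_iff hφ).2 hS))
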